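/- Let $n\ge 0$ be an integer and let $\mathcal A_n=\bigoplus_{\mathbb N}\mathbb Z/n\mathbb Z$ (so $\mathcal A_0=\bigoplus_{\mathbb N}\mathbb Z$), viewed as a discrete group. Let $\mathrm{Sub}(\mathcal A_n)$ be the space of subgroups of $\mathcal A_n$ with the Chabauty topology, i.e. the subspace topology from $\{0,1\}^{\mathcal A_n}$. A characteristic random subgroup of $\mathcal A_n$ is a Borel probability measure on $\mathrm{Sub}(\mathcal A_n)$ that is invariant under $\mathrm{Aut}(\mathcal A_n)$; it is indecomposable if it is an extreme point of the convex set of all characteristic random subgroups of $\mathcal A_n$. For an integer $m\ge 0$, a finite abelian group $F$ is said to be over $m$ if every nontrivial direct summand $F_1$ of $F$ satisfies $mF_1\ne 0$ (in particular the trivial group is over every $m$). Write $[F]$ for the isomorphism class of $F$, and let $m\mid n$ have the usual meaning, so that $m\mid 0$ for every $m\ge 0$, while $0\nmid n$ for $n\geq 1$. Theorem. Let $\lambda$ be an indecomposable characteristic random subgroup of $\mathcal A_n$. Then there is a unique pair $(m,[F])$, with $m\ge 0$ an integer and $F$ a finite abelian group over $m$, such that $m\mid n$, $nF=0$, and the random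 subgroup $m\mathcal A_n\cap\ker h$ has law $\lambda$, where $h$ is a random element of $\mathrm{Hom}(\mathcal A_n,F)$ whose law is the normalized Haar measure on the compact group $\mathrm{Hom}(\mathcal A_n,F)$ (with the topology of pointwise convergence). -/

import Mathlib

open MeasureTheory
open scoped NNReal

noncomputable section

namespace CharRandomSubgroup

/-- `𝒜 n = ⨁_ℕ ℤ/nℤ`. Since `ZMod 0 = ℤ`, `𝒜 0` is the free abelian group of countable rank. -/
abbrev 𝒜 (n : ℕ) : Type := ℕ →₀ ZMod n

section Subgroups

variable (G : Type*) [AddCommGroup G]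

/-- `Sub(G)`, the space of subgroups of a discrete abelian group `G`. -/
abbrev SubG : Type _ := AddSubgroup G

variable {G}

/-- The indicator function of a subgroup, as a point of `{0,1}^G`. -/
def SubG.indicator (H : SubG G) : G → Bool := by
  classical exact fun g => decide (g ∈ H)

/-- The Chabauty topology on `Sub(G)` for discrete `G`: the subspace topology from the product
space `{0,1}^G`, so that the sets `{H | g ∈ H}` and `{H | g ∉ H}` form a subbasis. -/
instance : TopologicalSpace (SubG G) :=
  TopologicalSpace.induced SubG.indicator inferInstance

instance : MeasurableSpace (SubG G) := borel _

instance : BorelSpace (SubG G) := ⟨rfl⟩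

variable (G)

/-- `CRS(G)`, the characteristic random subgroups of `G`: the Borel probability measures on
`Sub(G)` that are invariant under all automorphisms of `G`. -/
def CRS : Set (Measure (SubG G)) :=
  {μ | IsProbabilityMeasure μ ∧
    ∀ φ : G ≃+ G, μ.map (fun H : SubG G => H.map φ.toAddMonoidHom) = μ}

/-- `CRS^e(G)`, the indecomposable characteristic random subgroups: the extreme points of
`CRS(G)`. -/
def CRSe : Set (Measure (SubG G)) := Set.extremePoints ℝ≥0 (CRS G)

end Subgroups

section Hom

/-- The group `Hom(G, F)` of homomorphisms between discrete abelian groups. -/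
def HomGroup (G F : Type*) [AddCommGroup G] [AddCommGroup F] : Type _ := G →+ F

variable {G F : Type*} [AddCommGroup G] [AddCommGroup F]

instance : AddCommGroup (HomGroup G F) := inferInstanceAs (AddCommGroup (G →+ F))

instance : FunLike (HomGroup G F) G F := inferInstanceAs (FunLike (G →+ F) G F)

instance : AddMonoidHomClass (HomGroup G F) G F :=
  inferInstanceAs (AddMonoidHomClass (G →+ F) G F)

/-- The kernel of a homomorphism. -/
def HomGroup.ker (h : HomGroup G F) : SubG G := AddMonoidHom.ker (h : G →+ F)

/-- Evaluation of homomorphisms, as an additive map to the product group `F^G`. -/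
def HomGroup.evalHom : HomGroup G F →+ (G → F) where
  toFun h g := h g
  map_zero' := rfl
  map_add' _ _ := rfl

/-- The topology of pointwise convergence on `Hom(G, F)`, where `F` is discrete; as `G` is
discrete, it is the compact-open topology. -/
instance : TopologicalSpace (HomGroup G F) :=
  TopologicalSpace.induced HomGroup.evalHom (@Pi.topologicalSpace G (fun _ => F) fun _ => ⊥)

instance : IsTopologicalAddGroup (HomGroup G F) := by
  let : TopologicalSpace F := ⊥
  have : DiscreteTopology F := ⟨rfl⟩
  exact topologicalAddGroup_induced HomGroup.evalHom

instance [Finite F] : CompactSpace (HomGroup G F) := by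
  let : TopologicalSpace F := ⊥
  have : DiscreteTopology F := ⟨rfl⟩
  have hind : Topology.IsInducing (HomGroup.evalHom : HomGroup G F → G → F) := ⟨rfl⟩
  refine ⟨hind.isCompact_iff.2 ?_⟩
  refine IsClosed.isCompact ?_
  have : (HomGroup.evalHom : HomGroup G F → G → F) '' Set.univ =
      ⋂ (a : G) (b : G), {f : G → F | f (a + b) = f a + f b} := by
    ext f
    simp only [Set.image_univ, Set.mem_range, Set.mem_iInter, Set.mem_ofPred_eq]
    constructor
    · rintro ⟨h, rfl⟩ a b
      exact map_add h a b
    · intro hf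
      exact ⟨AddMonoidHom.mk' f hf, rfl⟩
  rw [this]
  refine isClosed_iInter fun a => isClosed_iInter fun b => isClosed_eq ?_ ?_ <;> fun_prop

instance : MeasurableSpace (HomGroup G F) := borel _

instance : BorelSpace (HomGroup G F) := ⟨rfl⟩

variable (G F)

/-- The Haar measure of the compact group `Hom(G, F)`, normalized to have total mass `1`. -/
def homHaar [Finite F] : Measure (HomGroup G F) := Measure.addHaarMeasure ⊤

end Hom

/-- A finite abelian group `F` is over `m` if no nontrivial direct summand `F₁` of `F` satisfies
`m F₁ = 0`. -/
def IsOver (m : ℕ) (F : Type*) [AddCommGroup F] : Prop :=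
  ∀ F₁ F₂ : AddSubgroup F, IsCompl F₁ F₂ → F₁ ≠ ⊥ → ∃ x ∈ F₁, m • x ≠ 0

/-- The subgroup `mG` of `G`. -/
def multiples (G : Type*) [AddCommGroup G] (m : ℕ) : SubG G := (nsmulAddMonoidHom m : G →+ G).range

/-- The law of the random subgroup `m 𝒜 n ∩ ker h`, where `h` is a Haar-random element of
`Hom(𝒜 n, F)`. -/
def kerLaw (n m : ℕ) (F : Type*) [AddCommGroup F] [Finite F] : Measure (SubG (𝒜 n)) :=
  (homHaar (𝒜 n) F).map fun h => multiples (𝒜 n) m ⊓ h.ker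

/-- `F` is over `m`, `m ∣ n`, `nF = 0`, and `m 𝒜 n ∩ ker h` has law `μ`. -/
structure IsDescribedBy (n : ℕ) (μ : Measure (SubG (𝒜 n))) (m : ℕ) (F : Type*) [AddCommGroup F]
    [Finite F] : Prop where
  isOver : IsOver m F
  dvd : m ∣ n
  nsmul_eq_zero : ∀ x : F, n • x = 0
  law : kerLaw n m F = μ

end CharRandomSubgroup

end

namespace CharRandomSubgroup

/-! ### The Chabauty Borel structure, invariant laws and ergodicity -/

section Chabauty

variable {G : Type*} [AddCommGroup G]

/-! The engine is a family of shears: automorphisms `1 + ψ`, where `ψ` kills a tail of `𝒜 n` and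
takes values in it. If a linear form takes the value `z` at `g`, shears turn the event `g ∈ H` into
`g + z • c ∈ H` for any `c` in a far tail. Inside a shear-invariant event on which `r` such elements
`c` are incongruent modulo `{x | z x ∈ H}`, these events are disjoint and equally likely, so `g ∈ H`
has conditional probability at most `1 / r`. Since tails almost surely meet as many cosets as the
whole group does, `g ∈ H` forces `{x | z x ∈ H}` to have finite index (`CRS.ae_finiteIndex_of_mem`).
The integers `z` with this property form a subgroup of `ℤ` containing `n` and the content of each
element of `H`. Its generator `m` divides `n`, satisfies `H ≤ m 𝒜 n`, and makes `K = 𝒜 n ⧸ {x | m x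
∈ H}` finite (`CRS.ae_exists_finiteIndex`).

There are countably many pairs `(m, K)` up to isomorphism, so ergodicity fixes one. The pair
determines the law: averaging over `|K| ^ k` shears turns the probability of `S ⊆ H` into a count of
homomorphisms to `K` (`CRS.pow_mul_measure_subset`), and division by `m` reduces general `m` to this
case (`CRS.eq_of_hasType`).

The law `kerLaw n m F` is characteristic, and when `n F = 0` it has pair `(m, m F)`, a Haar-random
homomorphism being almost surely onto. It remains to see that each occurring `K` is `m F` for an `F`
over `m` (`exists_isOver`), that `m F` determines such an `F` (`IsOver.nonempty_equiv`), and that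
`H` determines `m` (`HasType.dvd`). -/

theorem isClopen_setOf_mem (g : G) : IsClopen {H : SubG G | g ∈ H} := by
  have hc : Continuous fun H : SubG G => SubG.indicator H g :=
    (continuous_apply g).comp (continuous_induced_dom (f := (SubG.indicator : SubG G → G → Bool)))
  have : {H : SubG G | g ∈ H} = (fun H : SubG G => SubG.indicator H g) ⁻¹' {true} := by
    ext H
    simp [SubG.indicator]
  rw [this]
  exact (isClopen_discrete _).preimage hc

theorem measurableSet_setOf_mem (g : G) : MeasurableSet {H : SubG G | g ∈ H} :=
  (isClopen_setOf_mem g).isOpen.measurableSet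

theorem measurableSet_setOf_notMem (g : G) : MeasurableSet {H : SubG G | g ∉ H} :=
  (measurableSet_setOf_mem g).compl

theorem measurableSet_setOf_subset (S : Finset G) :
    MeasurableSet {H : SubG G | (S : Set G) ⊆ H} := by
  have : {H : SubG G | (S : Set G) ⊆ H} = ⋂ g ∈ S, {H : SubG G | g ∈ H} := by
    ext H
    simp [Set.subset_def]
  rw [this]
  exact Finset.measurableSet_biInter _ fun g _ => measurableSet_setOf_mem g

variable [Countable G]

theorem measurableSpace_eq_comap :
    (inferInstance : MeasurableSpace (SubG G)) =
      MeasurableSpace.comap SubG.indicator MeasurableSpace.pi := by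
  change borel _ = _
  have : (MeasurableSpace.pi : MeasurableSpace (G → Bool)) = borel _ := BorelSpace.measurable_eq
  rw [this, borel_comap]

theorem measurable_iff_mem {α : Type*} [MeasurableSpace α] {f : α → SubG G} :
    Measurable f ↔ ∀ g, MeasurableSet {x | g ∈ f x} := by
  refine ⟨fun h g => h (measurableSet_setOf_mem g), fun h => ?_⟩
  have : ∀ m : MeasurableSpace (SubG G),
      m = MeasurableSpace.comap SubG.indicator MeasurableSpace.pi → @Measurable _ _ _ m f := by
    rintro m rfl
    rw [measurable_comap_iff, measurable_pi_iff]
    intro g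
    refine measurable_to_bool ?_
    convert h g using 1
    ext x
    simp [SubG.indicator]
  exact this _ measurableSpace_eq_comap

/-- A random subgroup is determined by the probabilities that it contains given finite sets. -/
theorem measure_ext_of_subset {μ ν : Measure (SubG G)} [IsProbabilityMeasure μ]
    [IsProbabilityMeasure ν]
    (h : ∀ S : Finset G, μ {H | (S : Set G) ⊆ H} = ν {H | (S : Set G) ⊆ H}) : μ = ν := by
  refine ext_of_generate_finite (Set.range fun S : Finset G => {H : SubG G | (S : Set G) ⊆ H})
    ?_ ?_ ?_ (by simp)
  · refine le_antisymm ?_ ?_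
    · have : @Measurable _ _ (MeasurableSpace.generateFrom
          (Set.range fun S : Finset G => {H : SubG G | (S : Set G) ⊆ H})) _
          (id : SubG G → SubG G) := by
        rw [@measurable_iff_mem]
        intro g
        refine MeasurableSpace.measurableSet_generateFrom ⟨{g}, ?_⟩
        simp
      intro s hs
      exact this hs
    · refine MeasurableSpace.generateFrom_le ?_
      rintro _ ⟨S, rfl⟩
      exact measurableSet_setOf_subset S
  · classical
    rintro _ ⟨S, rfl⟩ _ ⟨T, rfl⟩ -
    refine ⟨S ∪ T, ?_⟩
    ext H
    simp
  · rintro _ ⟨S, rfl⟩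
    exact h S

theorem measurable_map_equiv (φ : G ≃+ G) :
    Measurable fun H : SubG G => (H.map φ.toAddMonoidHom : SubG G) := by
  refine measurable_iff_mem.2 fun g => ?_
  simp only [AddSubgroup.mem_map_equiv]
  exact measurableSet_setOf_mem _

theorem measurable_comap (f : G →+ G) : Measurable fun H : SubG G => (H.comap f : SubG G) :=
  measurable_iff_mem.2 fun g => measurableSet_setOf_mem (f g)

theorem measurable_map (f : G →+ G) : Measurable fun H : SubG G => (H.map f : SubG G) := by
  refine measurable_iff_mem.2 fun g => ?_
  have : {H : SubG G | g ∈ H.map f} = ⋃ x : {x // f x = g}, {H : SubG G | x.1 ∈ H} := by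
    ext H
    simp [AddSubgroup.mem_map, and_comm]
  rw [this]
  exact MeasurableSet.iUnion fun x => measurableSet_setOf_mem _

theorem CRS.map {μ : Measure (SubG G)} (hμ : μ ∈ CRS G) {f : SubG G → SubG G} (hf : Measurable f)
    (hcomm : ∀ (φ : G ≃+ G) (H : SubG G),
      f (H.map φ.toAddMonoidHom) = (f H).map φ.toAddMonoidHom) : μ.map f ∈ CRS G := by
  have := hμ.1
  refine ⟨Measure.isProbabilityMeasure_map hf.aemeasurable, fun φ => ?_⟩
  rw [Measure.map_map (measurable_map_equiv φ) hf]
  conv_rhs => rw [← hμ.2 φ, Measure.map_map hf (measurable_map_equiv φ)]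
  congr 1
  ext1 H
  exact (hcomm φ H).symm

theorem CRS.map_comap_zsmul {μ : Measure (SubG G)} (hμ : μ ∈ CRS G) (z : ℤ) :
    μ.map (fun H : SubG G => (H.comap (zsmulAddGroupHom z) : SubG G)) ∈ CRS G := by
  refine CRS.map hμ (measurable_comap _) fun φ H => ?_
  ext x
  simp only [AddSubgroup.mem_comap, AddSubgroup.mem_map_equiv, zsmulAddGroupHom_apply, map_zsmul]

theorem CRS.measure_preimage {μ : Measure (SubG G)} (hμ : μ ∈ CRS G) (φ : G ≃+ G)
    {s : Set (SubG G)} (hs : MeasurableSet s) :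
    μ {H | H.map φ.toAddMonoidHom ∈ s} = μ s := by
  conv_rhs => rw [← hμ.2 φ, Measure.map_apply (measurable_map_equiv φ) hs]
  rfl

theorem CRS.cond_mem {μ : Measure (SubG G)} (hμ : μ ∈ CRS G) {E : Set (SubG G)}
    (hE : MeasurableSet E) (hinv : ∀ (φ : G ≃+ G) (H : SubG G), H.map φ.toAddMonoidHom ∈ E ↔ H ∈ E)
    (h0 : μ E ≠ 0) : ProbabilityTheory.cond μ E ∈ CRS G := by
  have := hμ.1
  refine ⟨ProbabilityTheory.cond_isProbabilityMeasure h0, fun φ => ?_⟩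
  rw [ProbabilityTheory.cond, Measure.map_smul]
  congr 1
  have h1 : (fun H : SubG G => (H.map φ.toAddMonoidHom : SubG G)) ⁻¹' E = E := by
    ext H
    exact hinv φ H
  conv_lhs => rw [← h1]
  rw [← Measure.restrict_map (measurable_map_equiv φ) hE, hμ.2 φ]

/-- Indecomposable characteristic random subgroups are ergodic. -/
theorem CRSe.measure_eq_one {μ : Measure (SubG G)} (hμ : μ ∈ CRSe G) {E : Set (SubG G)}
    (hE : MeasurableSet E) (hinv : ∀ (φ : G ≃+ G) (H : SubG G), H.map φ.toAddMonoidHom ∈ E ↔ H ∈ E)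
    (h0 : μ E ≠ 0) : μ E = 1 := by
  have := hμ.1.1
  by_contra h1
  have hc : μ Eᶜ ≠ 0 := fun h => h1 ((prob_compl_eq_zero_iff hE).1 h)
  have hx := CRS.cond_mem hμ.1 hE hinv h0
  have hy := CRS.cond_mem hμ.1 hE.compl (fun φ H => not_congr (hinv φ H)) hc
  have hE' : μ E ≠ ⊤ := measure_ne_top _ _
  have hEc : μ Eᶜ ≠ ⊤ := measure_ne_top _ _
  -- `μ` is a proper convex combination of its conditionings on `E` and `Eᶜ`, so extremality
  -- identifies the first of them with `μ`.
  have key : ProbabilityTheory.cond μ E = μ := by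
    refine hμ.2 hx hy ⟨(μ E).toNNReal, (μ Eᶜ).toNNReal, ?_, ?_, ?_, ?_⟩
    · exact ENNReal.toNNReal_pos h0 hE'
    · exact ENNReal.toNNReal_pos hc hEc
    · rw [← ENNReal.toNNReal_add hE' hEc, prob_add_prob_compl hE, ENNReal.toNNReal_one]
    · have aux : ∀ s : Set (SubG G), μ s ≠ 0 →
          (μ s).toNNReal • ProbabilityTheory.cond μ s = μ.restrict s := by
        intro s hs
        change ((μ s).toNNReal : ENNReal) • ProbabilityTheory.cond μ s = μ.restrict s
        rw [ProbabilityTheory.cond, smul_smul,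
          ENNReal.coe_toNNReal (measure_ne_top _ _), ENNReal.mul_inv_cancel hs (measure_ne_top _ _),
          one_smul]
      rw [aux E h0, aux Eᶜ hc, Measure.restrict_add_restrict_compl hE]
  apply h1
  rw [← key, ProbabilityTheory.cond_apply hE, Set.inter_self, ENNReal.inv_mul_cancel h0 hE']

end Chabauty

/-- A comparison of two measures on the measurable subsets of each member of a countable family
extends to the union of the family. -/
theorem measure_iUnion_le_measure_iUnion {X : Type*} {mX : MeasurableSpace X} {ν₁ ν₂ : Measure X}
    {ι : Type*} [Countable ι] {s : ι → Set X} (hs : ∀ i, MeasurableSet (s i))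
    (h : ∀ i Q, MeasurableSet Q → Q ⊆ s i → ν₁ Q ≤ ν₂ Q) :
    ν₁ (⋃ i, s i) ≤ ν₂ (⋃ i, s i) := by
  rcases isEmpty_or_nonempty ι with hι | hι
  · simp
  obtain ⟨f, hf⟩ := exists_surjective_nat ι
  rw [← hf.iUnion_comp, ← iUnion_disjointed,
    measure_iUnion (disjoint_disjointed _) (MeasurableSet.disjointed fun i => hs _),
    measure_iUnion (disjoint_disjointed _) (MeasurableSet.disjointed fun i => hs _)]
  exact ENNReal.tsum_le_tsum fun i =>
    h (f i) _ (MeasurableSet.disjointed (fun i => hs _) i) (disjointed_subset _ i)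

/-! ### Shears and the events invariant under them -/

section Transvections

variable {G : Type*} [AddCommGroup G]

/-- The automorphism `1 + ψ` attached to an endomorphism `ψ` with `ψ² = 0`. -/
def transvection (ψ : G →+ G) (hψ : ∀ x, ψ (ψ x) = 0) : G ≃+ G where
  toFun x := x + ψ x
  invFun x := x - ψ x
  left_inv x := by simp [hψ]
  right_inv x := by simp [hψ]
  map_add' x y := by
    rw [map_add]
    abel

theorem mem_map_transvection (ψ : G →+ G) (hψ : ∀ x, ψ (ψ x) = 0) (H : SubG G) (x : G) :
    x ∈ H.map (transvection ψ hψ).toAddMonoidHom ↔ x - ψ x ∈ H :=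
  AddSubgroup.mem_map_equiv

/-- The endomorphisms that vanish on `T` and take values in `T`. -/
structure IsShear (T : AddSubgroup G) (ψ : G →+ G) : Prop where
  apply_eq_zero : ∀ t ∈ T, ψ t = 0
  apply_mem : ∀ x, ψ x ∈ T

theorem IsShear.apply_apply {T : AddSubgroup G} {ψ : G →+ G} (hψ : IsShear T ψ) (x : G) :
    ψ (ψ x) = 0 :=
  hψ.apply_eq_zero _ (hψ.apply_mem x)

/-- The `σ`-algebra of events that are invariant under all shears relative to `T`. -/
@[reducible]
def shearInvariant (T : AddSubgroup G) : MeasurableSpace (SubG G) where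
  MeasurableSet' s := MeasurableSet s ∧ ∀ (ψ : G →+ G) (hψ : IsShear T ψ) (H : SubG G),
    H.map (transvection ψ hψ.apply_apply).toAddMonoidHom ∈ s ↔ H ∈ s
  measurableSet_empty := ⟨MeasurableSet.empty, fun _ _ _ => Iff.rfl⟩
  measurableSet_compl s hs := ⟨hs.1.compl, fun ψ hψ H => not_congr (hs.2 ψ hψ H)⟩
  measurableSet_iUnion s hs := ⟨MeasurableSet.iUnion fun i => (hs i).1, fun ψ hψ H => by
    simp only [Set.mem_iUnion]
    exact exists_congr fun i => (hs i).2 ψ hψ H⟩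

theorem shearInvariant_le (T : AddSubgroup G) :
    shearInvariant T ≤ (inferInstance : MeasurableSpace (SubG G)) :=
  fun _ hs => hs.1

/-- The subgroups `H` such that the elements of `C` are pairwise incongruent modulo
`{x | z x ∈ H}`. -/
def separating (z : ℤ) (C : Finset G) : Set (SubG G) :=
  {H | ∀ c ∈ C, ∀ c' ∈ C, z • (c - c') ∈ H → c = c'}

theorem measurableSet_separating (z : ℤ) (C : Finset G) : MeasurableSet (separating z C) := by
  have : separating z C = ⋂ c ∈ C, ⋂ c' ∈ C, {H : SubG G | z • (c - c') ∈ H → c = c'} := by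
    ext H
    simp [separating]
  rw [this]
  refine Finset.measurableSet_biInter _ fun c _ => Finset.measurableSet_biInter _ fun c' _ => ?_
  by_cases h : c = c'
  · simp [h]
  · simpa [h] using measurableSet_setOf_notMem (z • (c - c'))

/-- Shears fix `T` pointwise, so conditions on elements of `T` are not affected by them. -/
theorem measurableSet_shearInvariant_separating {T : AddSubgroup G} (z : ℤ) {C : Finset G}
    (hC : ∀ c ∈ C, c ∈ T) : MeasurableSet[shearInvariant T] (separating z C) := by
  refine ⟨measurableSet_separating z C, fun ψ hψ H => ?_⟩
  refine forall₂_congr fun c hc => forall₂_congr fun c' hc' => ?_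
  rw [mem_map_transvection, hψ.apply_eq_zero (z • (c - c'))
    (T.zsmul_mem (T.sub_mem (hC c hc) (hC c' hc')) z), sub_zero]

theorem map_mem_separating [DecidableEq G] (φ : G ≃+ G) (z : ℤ) (C : Finset G) (H : SubG G) :
    H.map φ.toAddMonoidHom ∈ separating z (C.image φ) ↔ H ∈ separating z C := by
  simp only [separating, Set.mem_ofPred_eq, Finset.forall_mem_image, AddSubgroup.mem_map_equiv,
    map_zsmul, map_sub, AddEquiv.symm_apply_apply, EmbeddingLike.apply_eq_iff_eq]

/-- The subgroups `H` such that `T` meets at least `r` cosets of `{x | z x ∈ H}`. -/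
def largeIndex (z : ℤ) (T : AddSubgroup G) (r : ℕ) : Set (SubG G) :=
  ⋃ C : {C : Finset G // C.card = r ∧ ∀ c ∈ C, c ∈ T}, separating z C.1

theorem mem_largeIndex {z : ℤ} {T : AddSubgroup G} {r : ℕ} {H : SubG G} :
    H ∈ largeIndex z T r ↔
      ∃ C : Finset G, C.card = r ∧ (∀ c ∈ C, c ∈ T) ∧ H ∈ separating z C := by
  simp [largeIndex, and_assoc]

theorem largeIndex_mono (z : ℤ) (r : ℕ) {T T' : AddSubgroup G} (h : T ≤ T') :
    largeIndex z T r ⊆ largeIndex z T' r := by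
  intro H hH
  obtain ⟨C, hr, hC, hs⟩ := mem_largeIndex.1 hH
  exact mem_largeIndex.2 ⟨C, hr, fun c hc => h (hC c hc), hs⟩

theorem measurableSet_largeIndex [Countable G] (z : ℤ) (T : AddSubgroup G) (r : ℕ) :
    MeasurableSet (largeIndex z T r) :=
  MeasurableSet.iUnion fun C => measurableSet_separating z C.1

end Transvections

/-! ### Heads and tails of `𝒜 n` -/

section Tail

variable (n : ℕ)

instance : Countable (ZMod n) := by
  cases n with
  | zero => exact inferInstanceAs (Countable ℤ)
  | succ n => exact Finite.to_countable

/-- The elements of `𝒜 n` whose first `k` coordinates vanish. -/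
def tail (k : ℕ) : AddSubgroup (𝒜 n) where
  carrier := {a | ∀ i < k, a i = 0}
  zero_mem' _ _ := rfl
  add_mem' ha hb i hi := by simp [ha i hi, hb i hi]
  neg_mem' ha i hi := by simp [ha i hi]

/-- The elements of `𝒜 n` supported on the first `k` coordinates. -/
def head (k : ℕ) : AddSubgroup (𝒜 n) where
  carrier := {a | ∀ i, k ≤ i → a i = 0}
  zero_mem' _ _ := rfl
  add_mem' ha hb i hi := by simp [ha i hi, hb i hi]
  neg_mem' ha i hi := by simp [ha i hi]

variable {n}

theorem head_mono : Monotone (head n) := fun _ _ h _ ha i hi => ha i (h.trans hi)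

theorem exists_subset_head (S : Finset (𝒜 n)) : ∃ k, ∀ a ∈ S, a ∈ head n k := by
  refine ⟨S.sup (fun a => a.support.sup id + 1), fun a ha i hi => ?_⟩
  by_contra h
  have h1 : i ≤ a.support.sup id := Finset.le_sup (f := id) (Finsupp.mem_support_iff.2 h)
  have h2 : a.support.sup id + 1 ≤ S.sup (fun a => a.support.sup id + 1) :=
    Finset.le_sup (f := fun a : 𝒜 n => a.support.sup id + 1) ha
  omega

theorem exists_equiv_map_head_le_tail (N k : ℕ) :
    ∃ φ : 𝒜 n ≃+ 𝒜 n, ∀ a ∈ head n N, φ a ∈ tail n k := by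
  -- The involution `f` swaps the blocks `[0, M)` and `[M, 2M)`; `M ≥ k` and `M ≥ N` are what is
  -- needed.
  let M := k + N
  let f : ℕ → ℕ := fun i => if i < M then i + M else if i < 2 * M then i - M else i
  have hf : Function.Involutive f := by
    intro i
    simp only [f]
    split_ifs <;> omega
  refine ⟨Finsupp.domCongr hf.toPerm, fun a ha i hi => ?_⟩
  change (Finsupp.equivMapDomain hf.toPerm a) i = 0
  rw [Finsupp.equivMapDomain_apply]
  refine ha _ ?_
  change N ≤ f i
  simp only [f]
  split_ifs <;> omega

/-- Almost surely, a characteristic random subgroup has the same index in a tail of `𝒜 n` as in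
`𝒜 n`. -/
theorem CRS.ae_mem_largeIndex_tail {μ : Measure (SubG (𝒜 n))} (hμ : μ ∈ CRS (𝒜 n)) (z : ℤ)
    (k : ℕ) : ∀ᵐ H ∂μ, ∀ r, H ∈ largeIndex z ⊤ r → H ∈ largeIndex z (tail n k) r := by
  classical
  have := hμ.1
  refine ae_all_iff.2 fun r => ?_
  -- A finite set of coset representatives lies in some head, which an automorphism carries into the
  -- tail. The reverse inclusion of events being clear, equality of measures gives almost sure
  -- equality.
  have hle : μ (largeIndex z ⊤ r) ≤ μ (largeIndex z (tail n k) r) := by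
    have hU : largeIndex z (⊤ : AddSubgroup (𝒜 n)) r = ⋃ N, largeIndex z (head n N) r := by
      refine Set.Subset.antisymm (fun H hH => ?_)
        (Set.iUnion_subset fun N => largeIndex_mono z r le_top)
      obtain ⟨C, hr, -, hs⟩ := mem_largeIndex.1 hH
      obtain ⟨N, hN⟩ := exists_subset_head C
      exact Set.mem_iUnion.2 ⟨N, mem_largeIndex.2 ⟨C, hr, hN, hs⟩⟩
    have hmono : Monotone fun N => largeIndex z (head n N) r :=
      fun _ _ h => largeIndex_mono z r (head_mono h)
    rw [hU, hmono.measure_iUnion]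
    refine iSup_le fun N => ?_
    obtain ⟨φ, hφ⟩ := exists_equiv_map_head_le_tail (n := n) N k
    rw [← CRS.measure_preimage hμ φ (measurableSet_largeIndex z (tail n k) r)]
    refine measure_mono fun H hH => ?_
    obtain ⟨C, hr, hC, hs⟩ := mem_largeIndex.1 hH
    refine mem_largeIndex.2 ⟨C.image φ, ?_, ?_, (map_mem_separating φ z C H).2 hs⟩
    · rw [Finset.card_image_of_injective _ φ.injective, hr]
    · exact Finset.forall_mem_image.2 fun c hc => hφ c (hC c hc)
  have := ae_eq_of_subset_of_measure_ge (largeIndex_mono z r le_top) hle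
    (measurableSet_largeIndex z (tail n k) r).nullMeasurableSet (measure_ne_top _ _)
  filter_upwards [this.mem_iff] with H hH using hH.2

end Tail

/-! ### Finite index in `m 𝒜 n` -/

section FiniteIndex

variable {G : Type*} [AddCommGroup G]

theorem finiteIndex_comap_of_notMem_largeIndex {z : ℤ} {r : ℕ} {H : SubG G}
    (h : H ∉ largeIndex z ⊤ r) : (H.comap (zsmulAddGroupHom z : G →+ G)).FiniteIndex := by
  classical
  rcases finite_or_infinite (G ⧸ H.comap (zsmulAddGroupHom z : G →+ G)) with hf | hi
  · exact AddSubgroup.finiteIndex_of_finite_quotient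
  · refine absurd ?_ h
    obtain ⟨s, hs⟩ := Infinite.exists_subset_card_eq (G ⧸ H.comap (zsmulAddGroupHom z : G →+ G)) r
    refine mem_largeIndex.2 ⟨s.image Quotient.out, ?_, fun _ _ => AddSubgroup.mem_top _, ?_⟩
    · rw [Finset.card_image_of_injective _ Quotient.out_injective, hs]
    · simp only [separating, Set.mem_ofPred_eq, Finset.forall_mem_image]
      intro q _ q' _ hqq
      have : (QuotientAddGroup.mk q'.out : G ⧸ H.comap (zsmulAddGroupHom z : G →+ G)) =
          QuotientAddGroup.mk q.out := by
        rw [QuotientAddGroup.eq, AddSubgroup.mem_comap, zsmulAddGroupHom_apply, neg_add_eq_sub]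
        exact hqq
      rw [QuotientAddGroup.out_eq', QuotientAddGroup.out_eq'] at this
      rw [this]

end FiniteIndex

variable {n : ℕ}

/-- The projection of `𝒜 n` onto its first `k` coordinates. -/
def headProj (n k : ℕ) : 𝒜 n →+ 𝒜 n := Finsupp.filterAddHom fun i => i < k

theorem headProj_apply (k : ℕ) (a : 𝒜 n) (i : ℕ) :
    headProj n k a i = if i < k then a i else 0 :=
  Finsupp.filter_apply _ _ _

theorem headProj_of_mem_head {k : ℕ} {a : 𝒜 n} (ha : a ∈ head n k) : headProj n k a = a := by
  ext i
  rw [headProj_apply]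
  split_ifs with h
  · rfl
  · exact (ha i (not_lt.1 h)).symm

theorem headProj_of_mem_tail {k : ℕ} {a : 𝒜 n} (ha : a ∈ tail n k) : headProj n k a = 0 := by
  ext i
  rw [headProj_apply]
  split_ifs with h
  · exact ha i h
  · rfl

/-- The rank one map `x ↦ -l(x) c`, precomposed with the projection to the head. The sign is chosen
because membership in the image of `H` tests `g - ψ g`, which becomes `g + z • c`. -/
theorem exists_isShear_apply_eq {k : ℕ} {g : 𝒜 n} (hg : g ∈ head n k)
    (l : 𝒜 n →ₗ[ZMod n] ZMod n) {z : ℤ} (hz : l g = z) {c : 𝒜 n} (hc : c ∈ tail n k) :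
    ∃ ψ : 𝒜 n →+ 𝒜 n, IsShear (tail n k) ψ ∧ ψ g = -(z • c) := by
  refine ⟨((smulAddHom (ZMod n) (𝒜 n)).flip (-c)).comp
    (l.toAddMonoidHom.comp (headProj n k)), ⟨fun t ht => ?_, fun x => ?_⟩, ?_⟩
  · simp [headProj_of_mem_tail ht]
  · intro i hi
    simp [hc i hi]
  · simp [headProj_of_mem_head hg, hz, Int.cast_smul_eq_zsmul]

/-- For `r` separated elements `c` of the tail, the events `g + z • c ∈ H` are disjoint, and shears
show that they have the same probability as `g ∈ H`. -/
theorem CRS.mul_measure_mem_inter_largeIndex_le {μ : Measure (SubG (𝒜 n))} (hμ : μ ∈ CRS (𝒜 n))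
    {k : ℕ} {g : 𝒜 n} (hg : g ∈ head n k) (l : 𝒜 n →ₗ[ZMod n] ZMod n) {z : ℤ} (hz : l g = z)
    (r : ℕ) : r * μ (largeIndex z (tail n k) r ∩ {H | g ∈ H}) ≤ 1 := by
  have := hμ.1
  have hm := shearInvariant_le (tail n k)
  -- The set `C` depends on `H`, so the comparison is made piecewise. Trimming to the
  -- shear-invariant `σ`-algebra keeps the disjointified pieces invariant, as the transport by
  -- shears requires.
  have key : ((r : ENNReal) • μ.restrict {H | g ∈ H}).trim hm (largeIndex z (tail n k) r) ≤
      μ.trim hm (largeIndex z (tail n k) r) := by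
    refine measure_iUnion_le_measure_iUnion
      (fun C => measurableSet_shearInvariant_separating z C.2.2) ?_
    rintro ⟨C, hr, hC⟩ Q hQ hQC
    rw [trim_measurableSet_eq hm hQ, trim_measurableSet_eq hm hQ, Measure.smul_apply,
      Measure.restrict_apply hQ.1, smul_eq_mul]
    have hmeas := hQ.1.inter (measurableSet_setOf_mem g)
    have hEeq : ∀ c ∈ C, μ (Q ∩ {H | g + z • c ∈ H}) = μ (Q ∩ {H | g ∈ H}) := by
      intro c hc
      obtain ⟨ψ, hψ, hψg⟩ := exists_isShear_apply_eq hg l hz (hC c hc)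
      rw [← CRS.measure_preimage hμ (transvection ψ hψ.apply_apply) hmeas]
      congr 1
      ext H
      simp only [Set.mem_inter_iff, Set.mem_ofPred_eq, hQ.2 ψ hψ, mem_map_transvection, hψg,
        sub_neg_eq_add]
    have hsum : ∑ c ∈ C, μ (Q ∩ {H | g + z • c ∈ H}) = r * μ (Q ∩ {H | g ∈ H}) := by
      rw [Finset.sum_congr rfl hEeq, Finset.sum_const, hr, nsmul_eq_mul]
    rw [← hsum, ← measure_biUnion_finset ?_
      fun c _ => hQ.1.inter (measurableSet_setOf_mem _)]
    · exact measure_mono (Set.iUnion₂_subset fun c _ => Set.inter_subset_left)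
    · intro c hc c' hc' hne
      refine Set.disjoint_left.2 fun H h1 h2 => hne (hQC h1.1 c hc c' hc' ?_)
      have := H.sub_mem h1.2 h2.2
      rwa [add_sub_add_left_eq_sub, ← zsmul_sub] at this
  have hU : MeasurableSet[shearInvariant (tail n k)] (largeIndex z (tail n k) r) :=
    MeasurableSet.iUnion fun C => measurableSet_shearInvariant_separating z C.2.2
  rw [trim_measurableSet_eq hm hU, trim_measurableSet_eq hm hU, Measure.smul_apply,
    Measure.restrict_apply hU.1, smul_eq_mul] at key
  exact key.trans prob_le_one

theorem CRS.ae_finiteIndex_of_mem {μ : Measure (SubG (𝒜 n))} (hμ : μ ∈ CRS (𝒜 n)) (g : 𝒜 n)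
    (l : 𝒜 n →ₗ[ZMod n] ZMod n) {z : ℤ} (hz : l g = z) :
    ∀ᵐ H ∂μ, g ∈ H → (H.comap (zsmulAddGroupHom z : 𝒜 n →+ 𝒜 n)).FiniteIndex := by
  obtain ⟨k, hk⟩ := exists_subset_head {g}
  have hg : g ∈ head n k := hk g (Finset.mem_singleton_self g)
  -- An event of positive probability would violate the bound `1 / r` for large `r`.
  have hnull : μ {H | g ∈ H ∧ ∀ r, H ∈ largeIndex z (tail n k) r} = 0 := by
    by_contra h0
    obtain ⟨r, hr⟩ := ENNReal.exists_nat_mul_gt h0 ENNReal.one_ne_top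
    refine absurd hr (not_lt.2 (le_trans ?_ (CRS.mul_measure_mem_inter_largeIndex_le hμ hg l hz r)))
    gcongr
    exact fun H hH => ⟨hH.2 r, hH.1⟩
  filter_upwards [CRS.ae_mem_largeIndex_tail hμ z k, measure_eq_zero_iff_ae_notMem.1 hnull]
    with H h1 h2 hgH
  have : ∃ r, H ∉ largeIndex z ⊤ r := by
    by_contra! h
    exact h2 ⟨hgH, fun r => h1 r (h r)⟩
  obtain ⟨r, hr⟩ := this
  exact finiteIndex_comap_of_notMem_largeIndex hr

/-- Every element of `𝒜 n` is a multiple of its content, which is the value at that element of a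
linear form. -/
theorem exists_content (g : 𝒜 n) :
    ∃ (z : ℤ) (l : 𝒜 n →ₗ[ZMod n] ZMod n) (t : 𝒜 n), l g = z ∧ g = z • t := by
  classical
  have : IsPrincipalIdealRing (ZMod n) :=
    IsPrincipalIdealRing.of_surjective (Int.castRingHom (ZMod n)) ZMod.intCast_surjective
  -- The values at `g` of all linear forms. The coordinates of `g` are among them, so a generator
  -- divides every coordinate and is itself a value.
  let I : Ideal (ZMod n) :=
    LinearMap.range (LinearMap.applyₗ g : (𝒜 n →ₗ[ZMod n] ZMod n) →ₗ[ZMod n] ZMod n)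
  obtain ⟨d, hd⟩ := (IsPrincipalIdealRing.principal I).principal
  obtain ⟨z, rfl⟩ := ZMod.intCast_surjective d
  have hzI : (z : ZMod n) ∈ I := hd ▸ Submodule.mem_span_singleton_self _
  obtain ⟨l, hl⟩ := hzI
  have hdvd : ∀ i, ∃ s : ZMod n, g i = z * s := by
    intro i
    have : g i ∈ I := ⟨Finsupp.lapply i, rfl⟩
    rw [hd] at this
    obtain ⟨s, hs⟩ := Submodule.mem_span_singleton.1 this
    exact ⟨s, by rw [← hs, smul_eq_mul, mul_comm]⟩
  choose s hs using hdvd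
  -- The chosen quotient `s i` need not vanish where `g i = 0`, so it is reset to `0` there to keep
  -- the support finite.
  refine ⟨z, l, Finsupp.onFinset g.support (fun i => if g i = 0 then 0 else s i) ?_, hl, ?_⟩
  · intro i hi
    rw [Finsupp.mem_support_iff]
    intro h
    simp [h] at hi
  · ext i
    rw [Finsupp.smul_apply, Finsupp.onFinset_apply]
    split_ifs with h
    · simp [h]
    · rw [zsmul_eq_mul, ← hs]

/-- Almost surely, a characteristic random subgroup of `𝒜 n` is a finite index subgroup of
`m 𝒜 n` for some `m ∣ n`. -/
theorem CRS.ae_exists_finiteIndex {μ : Measure (SubG (𝒜 n))} (hμ : μ ∈ CRS (𝒜 n)) :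
    ∀ᵐ H ∂μ, ∃ m : ℕ, m ∣ n ∧ H ≤ multiples (𝒜 n) m ∧
      (H.comap (zsmulAddGroupHom m : 𝒜 n →+ 𝒜 n)).FiniteIndex := by
  choose z l t hl ht using exists_content (n := n)
  filter_upwards [ae_all_iff.2 fun g => CRS.ae_finiteIndex_of_mem hμ g (l g) (hl g)] with H hH
  -- The multipliers giving finite index form a subgroup of `ℤ` that contains `n` and the content of
  -- every element of `H`; its generator is the required `m`.
  let I : AddSubgroup ℤ :=
    { carrier := {z | (H.comap (zsmulAddGroupHom z : 𝒜 n →+ 𝒜 n)).FiniteIndex}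
      zero_mem' := by
        have : H.comap (zsmulAddGroupHom 0 : 𝒜 n →+ 𝒜 n) = ⊤ := by
          ext x
          simp
        rw [Set.mem_ofPred_eq, this]
        infer_instance
      add_mem' := by
        intro a b (ha : AddSubgroup.FiniteIndex _) (hb : AddSubgroup.FiniteIndex _)
        refine @AddSubgroup.finiteIndex_of_le _ _ (H.comap (zsmulAddGroupHom a : 𝒜 n →+ 𝒜 n) ⊓
          H.comap (zsmulAddGroupHom b : 𝒜 n →+ 𝒜 n)) _ inferInstance fun x hx => ?_
        simp only [AddSubgroup.mem_comap, zsmulAddGroupHom_apply, add_zsmul]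
        exact H.add_mem hx.1 hx.2
      neg_mem' := by
        intro a (ha : AddSubgroup.FiniteIndex _)
        have : H.comap (zsmulAddGroupHom (-a) : 𝒜 n →+ 𝒜 n) = H.comap (zsmulAddGroupHom a) := by
          ext x
          simp
        rw [Set.mem_ofPred_eq, this]
        exact ha }
  obtain ⟨d, hd⟩ := Int.subgroup_cyclic I
  have hdvd : ∀ x ∈ I, ((d.natAbs : ℕ) : ℤ) ∣ x := by
    intro x hx
    rw [hd, ← AddSubgroup.zmultiples_eq_closure, Int.mem_zmultiples_iff] at hx
    exact Int.natAbs_dvd.2 hx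
  refine ⟨d.natAbs, ?_, ?_, ?_⟩
  · refine Int.natCast_dvd_natCast.1 (hdvd n ?_)
    have : H.comap (zsmulAddGroupHom n : 𝒜 n →+ 𝒜 n) = ⊤ := by
      ext x
      have : (n : ℤ) • x = 0 := by
        ext i
        simp
      simp [this]
    change (H.comap (zsmulAddGroupHom n : 𝒜 n →+ 𝒜 n)).FiniteIndex
    rw [this]
    infer_instance
  · intro g hg
    obtain ⟨q, hq⟩ := hdvd _ (hH g hg)
    refine ⟨q • t g, ?_⟩
    conv_rhs => rw [ht g, hq]
    rw [mul_zsmul, nsmulAddMonoidHom_apply, natCast_zsmul]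
  · have : (d.natAbs : ℤ) ∈ I := by
      rw [hd, ← AddSubgroup.zmultiples_eq_closure, Int.mem_zmultiples_iff]
      exact Int.dvd_natAbs_self
    exact this

/-! ### Uniqueness of the law with a given finite quotient -/

/-- `H` is the kernel of a surjective homomorphism onto `K`, that is, `G ⧸ H ≃ K`. -/
def IsKernelOnto {G : Type*} [AddCommGroup G] (K : Type*) [AddCommGroup K] (H : SubG G) : Prop :=
  ∃ f : G →+ K, Function.Surjective f ∧ f.ker = H

theorem IsKernelOnto.mem_largeIndex_top {G K : Type*} [AddCommGroup G] [AddCommGroup K] [Finite K]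
    {H : SubG G} (h : IsKernelOnto K H) : H ∈ largeIndex 1 ⊤ (Nat.card K) := by
  classical
  obtain ⟨f, hf, rfl⟩ := h
  have := Fintype.ofFinite K
  refine mem_largeIndex.2 ⟨Finset.univ.image (Function.surjInv hf), ?_,
    fun _ _ => AddSubgroup.mem_top _, ?_⟩
  · rw [Finset.card_image_of_injective _ (Function.injective_surjInv hf), Finset.card_univ,
      Nat.card_eq_fintype_card]
  · simp only [separating, Set.mem_ofPred_eq, Finset.forall_mem_image, one_zsmul]
    intro x _ y _ hxy
    rw [AddMonoidHom.mem_ker, map_sub, Function.surjInv_eq hf, Function.surjInv_eq hf,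
      sub_eq_zero] at hxy
    rw [hxy]

variable {n : ℕ}

theorem addMonoidHom_ext_single {K : Type*} [AddCommGroup K] {f g : 𝒜 n →+ K}
    (h : ∀ i, f (Finsupp.single i 1) = g (Finsupp.single i 1)) : f = g := by
  refine Finsupp.addHom_ext fun i x => ?_
  obtain ⟨z, rfl⟩ := ZMod.intCast_surjective x
  have : (Finsupp.single i (z : ZMod n) : 𝒜 n) = z • Finsupp.single i 1 := by
    rw [Finsupp.smul_single, zsmul_one]
  rw [this, map_zsmul, map_zsmul, h i]

/-- The endomorphism of `𝒜 n` that sends the `i`-th basis vector to `c i` for `i < k` and kills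
the other basis vectors. -/
noncomputable def shear {k : ℕ} (c : Fin k → 𝒜 n) : 𝒜 n →+ 𝒜 n :=
  ∑ i, ((smulAddHom (ZMod n) (𝒜 n)).flip (c i)).comp (Finsupp.applyAddHom (i : ℕ))

theorem shear_apply {k : ℕ} (c : Fin k → 𝒜 n) (a : 𝒜 n) : shear c a = ∑ i : Fin k, a i • c i := by
  simp [shear, AddMonoidHom.finsetSum_apply]

theorem shear_single {k : ℕ} (c : Fin k → 𝒜 n) (i : Fin k) :
    shear c (Finsupp.single (i : ℕ) 1) = c i := by
  rw [shear_apply, Finset.sum_eq_single i]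
  · simp
  · intro j _ hj
    rw [Finsupp.single_eq_of_ne (by simpa [Fin.ext_iff] using hj), zero_smul]
  · simp

theorem isShear_shear {k : ℕ} {c : Fin k → 𝒜 n} (hc : ∀ i, c i ∈ tail n k) :
    IsShear (tail n k) (shear c) := by
  refine ⟨fun t ht => ?_, fun x => ?_⟩
  · rw [shear_apply]
    exact Finset.sum_eq_zero fun i _ => by rw [ht i i.2, zero_smul]
  · rw [shear_apply]
    refine AddSubgroup.sum_mem _ fun i _ j hj => ?_
    simp [hc i j hj]

variable (n) in
/-- The number of homomorphisms to `K` that vanish on `S` and on the tail of `𝒜 n`. -/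
noncomputable def numHom (k : ℕ) (K : Type*) [AddCommGroup K] (S : Finset (𝒜 n)) : ℕ :=
  Nat.card {g : 𝒜 n →+ K // (∀ t ∈ tail n k, g t = 0) ∧ ∀ s ∈ S, g s = 0}

/-- If `H = ker f`, then `f` maps `C` bijectively onto `K`. Hence, as `c` runs through `C ^ k`, the
map `f ∘ (1 - shear c) ∘ headProj` runs exactly once through the homomorphisms that kill the tail,
and it kills `s` precisely when `s - shear c s ∈ H`. The count thus depends on `H` only through `K`.
-/
theorem card_filter_shear {K : Type*} [AddCommGroup K] [Finite K] {k : ℕ} {S : Finset (𝒜 n)}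
    (hS : ∀ s ∈ S, s ∈ head n k) {C : Finset (𝒜 n)} (hC : ∀ c ∈ C, c ∈ tail n k)
    (hcard : C.card = Nat.card K) {H : SubG (𝒜 n)} (hsep : H ∈ separating 1 C)
    (hH : IsKernelOnto K H)
    [DecidablePred fun c : Fin k → 𝒜 n => ∀ s ∈ S, s - shear c s ∈ H] :
    ((Fintype.piFinset fun _ : Fin k => C).filter fun c => ∀ s ∈ S, s - shear c s ∈ H).card =
      numHom n k K S := by
  obtain ⟨f, hf, rfl⟩ := hH
  have hinj : ∀ c ∈ C, ∀ c' ∈ C, f c = f c' → c = c' := by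
    intro c hc c' hc' h
    refine hsep c hc c' hc' ?_
    rw [one_zsmul, AddMonoidHom.mem_ker, map_sub, h, sub_self]
  have hsurj : ∀ y : K, ∃ c ∈ C, f c = y := by
    classical
    have := Fintype.ofFinite K
    have himg : C.image f = Finset.univ := by
      refine Finset.eq_univ_of_card _ ?_
      rw [Finset.card_image_of_injOn fun c hc c' hc' => hinj c hc c' hc', hcard,
        Nat.card_eq_fintype_card]
    intro y
    have := himg ▸ Finset.mem_univ y
    simpa using this
  have hshear : ∀ c ∈ Fintype.piFinset fun _ : Fin k => C, IsShear (tail n k) (shear c) :=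
    fun c hc => isShear_shear fun i => hC _ (Fintype.mem_piFinset.1 hc i)
  let Φ : (Fin k → 𝒜 n) → 𝒜 n →+ K := fun c =>
    f.comp ((AddMonoidHom.id _ - shear c).comp (headProj n k))
  have hΦ : ∀ c i, Φ c (Finsupp.single (i : Fin k).1 1) =
      f (Finsupp.single (i : Fin k).1 1) - f (c i) := by
    intro c i
    have : (Finsupp.single i.1 1 : 𝒜 n) ∈ head n k := fun j hj =>
      Finsupp.single_eq_of_ne (by have := i.2; omega)
    simp only [Φ, AddMonoidHom.comp_apply, headProj_of_mem_head this, AddMonoidHom.sub_apply,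
      AddMonoidHom.id_apply, shear_single, map_sub]
  have hΦtail : ∀ c, ∀ t ∈ tail n k, Φ c t = 0 := by
    intro c t ht
    simp only [Φ, AddMonoidHom.comp_apply, headProj_of_mem_tail ht, map_zero]
  have hΦhead : ∀ c, ∀ s ∈ S, Φ c s = f (s - shear c s) := by
    intro c s hs
    simp only [Φ, AddMonoidHom.comp_apply, headProj_of_mem_head (hS s hs),
      AddMonoidHom.sub_apply, AddMonoidHom.id_apply]
  rw [numHom, ← Nat.card_eq_finsetCard]
  refine Nat.card_eq_of_bijective (fun c => ⟨Φ c.1, hΦtail c.1, fun s hs => ?_⟩) ⟨?_, ?_⟩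
  · rw [hΦhead _ s hs]
    exact (Finset.mem_filter.1 c.2).2 s hs
  · rintro ⟨c, hc⟩ ⟨c', hc'⟩ hcc'
    have h1 : Φ c = Φ c' := congrArg Subtype.val hcc'
    rw [Finset.mem_filter, Fintype.mem_piFinset] at hc hc'
    refine Subtype.ext (funext fun i => hinj _ (hc.1 i) _ (hc'.1 i) ?_)
    have h2 := DFunLike.congr_fun h1 (Finsupp.single i.1 1)
    rw [hΦ, hΦ] at h2
    exact sub_right_injective h2
  · rintro ⟨g, hgt, hgS⟩
    choose r hrC hr using hsurj
    -- Solves `f (e i) - f (c i) = g (e i)` on the first `k` basis vectors.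
    let c : Fin k → 𝒜 n := fun i =>
      r (f (Finsupp.single i.1 1) - g (Finsupp.single i.1 1))
    have hgc : Φ c = g := by
      refine addMonoidHom_ext_single fun i => ?_
      by_cases hi : i < k
      · have := hΦ c ⟨i, hi⟩
        simp only [c, hr] at this
        rw [this, sub_sub_cancel]
      · have ht : (Finsupp.single i 1 : 𝒜 n) ∈ tail n k := fun j hj =>
          Finsupp.single_eq_of_ne (by omega)
        rw [hΦtail c _ ht, hgt _ ht]
    refine ⟨⟨c, Finset.mem_filter.2 ⟨Fintype.mem_piFinset.2 fun i => hrC _, fun s hs => ?_⟩⟩,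
      Subtype.ext hgc⟩
    rw [AddMonoidHom.mem_ker, ← hΦhead c s hs, hgc]
    exact hgS s hs

/-- The probability that a characteristic random subgroup with quotient `K` contains `S`. -/
theorem CRS.pow_mul_measure_subset {K : Type*} [AddCommGroup K] [Finite K]
    {μ : Measure (SubG (𝒜 n))}
    (hμ : μ ∈ CRS (𝒜 n)) (hK : ∀ᵐ H ∂μ, IsKernelOnto K H) {k : ℕ} {S : Finset (𝒜 n)}
    (hS : ∀ s ∈ S, s ∈ head n k) :
    (Nat.card K ^ k : ℕ) * μ {H | (S : Set (𝒜 n)) ⊆ H} = numHom n k K S := by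
  classical
  have := hμ.1
  have hm := shearInvariant_le (tail n k)
  set E : Set (SubG (𝒜 n)) := {H | (S : Set (𝒜 n)) ⊆ H} with hE
  have hEm : MeasurableSet E := measurableSet_setOf_subset S
  set U : Set (SubG (𝒜 n)) := largeIndex 1 (tail n k) (Nat.card K) with hU
  have hUm : MeasurableSet[shearInvariant (tail n k)] U :=
    MeasurableSet.iUnion fun C => measurableSet_shearInvariant_separating 1 C.2.2
  have hU1 : ∀ᵐ H ∂μ, H ∈ U := by
    filter_upwards [hK, CRS.ae_mem_largeIndex_tail hμ 1 k] with H h1 h2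
    exact h2 _ h1.mem_largeIndex_top
  have hpiece : ∀ (C : {C : Finset (𝒜 n) // C.card = Nat.card K ∧ ∀ c ∈ C, c ∈ tail n k}) Q,
      MeasurableSet[shearInvariant (tail n k)] Q → Q ⊆ separating 1 C.1 →
      (((Nat.card K ^ k : ℕ) : ENNReal) • μ.restrict E).trim hm Q =
        ((numHom n k K S : ENNReal) • μ).trim hm Q := by
    rintro ⟨C, hcard, hC⟩ Q hQ hQC
    rw [trim_measurableSet_eq hm hQ, trim_measurableSet_eq hm hQ, Measure.smul_apply,
      Measure.smul_apply, Measure.restrict_apply hQ.1, smul_eq_mul, smul_eq_mul]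
    let E' : (Fin k → 𝒜 n) → Set (SubG (𝒜 n)) := fun c => {H | ∀ s ∈ S, s - shear c s ∈ H}
    have hE'm : ∀ c, MeasurableSet (E' c) := fun c => by
      have : E' c = ⋂ s ∈ S, {H : SubG (𝒜 n) | s - shear c s ∈ H} := by
        ext H
        simp [E']
      rw [this]
      exact Finset.measurableSet_biInter _ fun s _ => measurableSet_setOf_mem _
    have hEeq : ∀ c ∈ Fintype.piFinset fun _ : Fin k => C, μ (Q ∩ E' c) = μ (Q ∩ E) := by
      intro c hc
      have hψ : IsShear (tail n k) (shear c) :=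
        isShear_shear fun i => hC _ (Fintype.mem_piFinset.1 hc i)
      rw [← CRS.measure_preimage hμ (transvection _ hψ.apply_apply) (hQ.1.inter hEm)]
      congr 1
      ext H
      simp only [Set.mem_inter_iff, Set.mem_ofPred_eq, hQ.2 _ hψ, hE, Set.subset_def,
        SetLike.mem_coe, mem_map_transvection, E']
    have hcardpi : (Fintype.piFinset fun _ : Fin k => C).card = Nat.card K ^ k := by
      rw [Fintype.card_piFinset_const, hcard]
    -- Double counting: the `|K| ^ k` sheared copies of `E` have equal mass inside `Q`, and almost
    -- every `H` in `Q` lies in exactly `numHom n k K S` of them.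
    calc ((Nat.card K ^ k : ℕ) : ENNReal) * μ (Q ∩ E)
        = ∑ c ∈ Fintype.piFinset fun _ : Fin k => C, μ (Q ∩ E' c) := by
          rw [Finset.sum_congr rfl hEeq, Finset.sum_const, hcardpi, nsmul_eq_mul]
      _ = ∑ c ∈ Fintype.piFinset fun _ : Fin k => C,
            ∫⁻ H in Q, (E' c).indicator (fun _ => 1) H ∂μ := by
          refine Finset.sum_congr rfl fun c _ => ?_
          rw [lintegral_indicator (hE'm c), setLIntegral_one, Measure.restrict_apply (hE'm c),
            Set.inter_comm]
      _ = ∫⁻ H in Q, ∑ c ∈ Fintype.piFinset fun _ : Fin k => C,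
            (E' c).indicator (fun _ => 1) H ∂μ := by
          rw [lintegral_finsetSum _ fun c _ => measurable_const.indicator (hE'm c)]
      _ = ∫⁻ H in Q, (numHom n k K S : ENNReal) ∂μ := by
          refine setLIntegral_congr_fun_ae hQ.1 ?_
          filter_upwards [hK] with H hH hHQ
          rw [← card_filter_shear hS hC hcard (hQC hHQ) hH, Finset.card_filter]
          push_cast
          refine Finset.sum_congr rfl fun c _ => ?_
          simp [Set.indicator_apply, E']
      _ = numHom n k K S * μ Q := by rw [setLIntegral_const]
  have key : (((Nat.card K ^ k : ℕ) : ENNReal) • μ.restrict E).trim hm U =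
      ((numHom n k K S : ENNReal) • μ).trim hm U := by
    refine le_antisymm ?_ ?_
    · exact measure_iUnion_le_measure_iUnion
        (fun C => measurableSet_shearInvariant_separating 1 C.2.2)
        fun C Q hQ hQC => (hpiece C Q hQ hQC).le
    · exact measure_iUnion_le_measure_iUnion
        (fun C => measurableSet_shearInvariant_separating 1 C.2.2)
        fun C Q hQ hQC => (hpiece C Q hQ hQC).ge
  rw [trim_measurableSet_eq hm hUm, trim_measurableSet_eq hm hUm, Measure.smul_apply,
    Measure.smul_apply, Measure.restrict_apply hUm.1, smul_eq_mul, smul_eq_mul,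
    (mem_ae_iff_prob_eq_one hUm.1).1 hU1, mul_one] at key
  rw [← key]
  congr 1
  refine measure_congr ?_
  filter_upwards [hU1] with H hH
  exact propext ⟨fun h => ⟨hH, h⟩, fun h => h.2⟩

/-- There is at most one characteristic random subgroup of `𝒜 n` with quotient `K`. -/
theorem CRS.eq_of_isKernelOnto {K : Type*} [AddCommGroup K] [Finite K]
    {μ ν : Measure (SubG (𝒜 n))} (hμ : μ ∈ CRS (𝒜 n)) (hν : ν ∈ CRS (𝒜 n))
    (hμK : ∀ᵐ H ∂μ, IsKernelOnto K H) (hνK : ∀ᵐ H ∂ν, IsKernelOnto K H) : μ = ν := by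
  have := hμ.1
  have := hν.1
  refine measure_ext_of_subset fun S => ?_
  obtain ⟨k, hk⟩ := exists_subset_head S
  have h := (CRS.pow_mul_measure_subset hμ hμK hk).trans
    (CRS.pow_mul_measure_subset hν hνK hk).symm
  refine (ENNReal.mul_right_inj ?_ (ENNReal.natCast_ne_top _)).1 h
  exact Nat.cast_ne_zero.2 (pow_ne_zero _ Nat.card_pos.ne')

/-! ### The type `(m, K)` of a subgroup -/

section Types

variable {G : Type*} [AddCommGroup G] {K : Type*} [AddCommGroup K]

/-- A set-theoretic section modulo `H` expresses the quotient by membership conditions alone. For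
countable `G` and finite `K` there are countably many candidates `c`, which gives measurability. -/
theorem isKernelOnto_iff_exists_section {H : SubG G} :
    IsKernelOnto K H ↔ ∃ c : K → G, (∀ x y, c x + c y - c (x + y) ∈ H) ∧
      (∀ a, ∃ x, a - c x ∈ H) ∧ ∀ x, c x ∈ H → x = 0 := by
  constructor
  · rintro ⟨f, hf, rfl⟩
    refine ⟨Function.surjInv hf, fun x y => ?_, fun a => ⟨f a, ?_⟩, fun x hx => ?_⟩
    · simp [AddMonoidHom.mem_ker, Function.surjInv_eq hf]
    · simp [AddMonoidHom.mem_ker, Function.surjInv_eq hf]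
    · rwa [AddMonoidHom.mem_ker, Function.surjInv_eq hf] at hx
  · rintro ⟨c, hadd, hsurj, hinj⟩
    let e : K →+ G ⧸ H := AddMonoidHom.mk' (fun x => (c x : G ⧸ H)) fun x y => by
      rw [← QuotientAddGroup.mk_add, QuotientAddGroup.eq, neg_add_eq_sub]
      exact hadd x y
    have he : Function.Bijective e := by
      constructor
      · rw [injective_iff_map_eq_zero]
        exact fun x hx => hinj x ((QuotientAddGroup.eq_zero_iff _).1 hx)
      · intro q
        obtain ⟨a, rfl⟩ := QuotientAddGroup.mk_surjective q
        obtain ⟨x, hx⟩ := hsurj a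
        refine ⟨x, ?_⟩
        change ((c x : G) : G ⧸ H) = a
        rw [QuotientAddGroup.eq, neg_add_eq_sub]
        exact hx
    let E := AddEquiv.ofBijective e he
    refine ⟨E.symm.toAddMonoidHom.comp (QuotientAddGroup.mk' H),
      E.symm.surjective.comp (QuotientAddGroup.mk'_surjective H), ?_⟩
    ext a
    simp

theorem measurableSet_isKernelOnto [Countable G] [Finite K] :
    MeasurableSet {H : SubG G | IsKernelOnto K H} := by
  have : {H : SubG G | IsKernelOnto K H} = ⋃ c : K → G,
      ((⋂ x, ⋂ y, {H : SubG G | c x + c y - c (x + y) ∈ H}) ∩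
      (⋂ a, ⋃ x, {H : SubG G | a - c x ∈ H})) ∩ ⋂ x, {H : SubG G | c x ∈ H → x = 0} := by
    ext H
    simp [isKernelOnto_iff_exists_section, and_assoc]
  rw [this]
  refine MeasurableSet.iUnion fun c => ((MeasurableSet.iInter fun x => MeasurableSet.iInter fun y =>
    measurableSet_setOf_mem _).inter (MeasurableSet.iInter fun a => MeasurableSet.iUnion fun x =>
    measurableSet_setOf_mem _)).inter (MeasurableSet.iInter fun x => ?_)
  by_cases h : x = 0
  · simp [h]
  · simpa [h] using measurableSet_setOf_notMem (c x)

theorem IsKernelOnto.map_equiv {H : SubG G} (h : IsKernelOnto K H) (φ : G ≃+ G) :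
    IsKernelOnto K (H.map φ.toAddMonoidHom : SubG G) := by
  obtain ⟨f, hf, rfl⟩ := h
  refine ⟨f.comp φ.symm.toAddMonoidHom, hf.comp φ.symm.surjective, ?_⟩
  ext x
  rw [AddSubgroup.mem_map_equiv, AddMonoidHom.mem_ker, AddMonoidHom.mem_ker]
  rfl

theorem IsKernelOnto.congr {K' : Type*} [AddCommGroup K'] {H : SubG G} (h : IsKernelOnto K H)
    (e : K ≃+ K') : IsKernelOnto K' H := by
  obtain ⟨f, hf, rfl⟩ := h
  refine ⟨e.toAddMonoidHom.comp f, e.surjective.comp hf, ?_⟩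
  ext x
  simp [AddMonoidHom.mem_ker]

theorem IsKernelOnto.equiv {K' : Type*} [AddCommGroup K'] {H : SubG G} (h : IsKernelOnto K H)
    (h' : IsKernelOnto K' H) : Nonempty (K ≃+ K') := by
  obtain ⟨f, hf, hk⟩ := h
  obtain ⟨f', hf', hk'⟩ := h'
  exact ⟨(QuotientAddGroup.quotientKerEquivOfSurjective f hf).symm.trans
    ((QuotientAddGroup.quotientAddEquivOfEq (hk.trans hk'.symm)).trans
      (QuotientAddGroup.quotientKerEquivOfSurjective f' hf'))⟩

theorem mem_multiples {m : ℕ} {g : G} : g ∈ multiples G m ↔ ∃ a, m • a = g := Iff.rfl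

/-- The subgroup `{x | m x ∈ H}`. -/
abbrev divide (m : ℕ) (H : SubG G) : SubG G := H.comap (zsmulAddGroupHom (m : ℤ) : G →+ G)

theorem mem_divide {m : ℕ} {H : SubG G} {x : G} : x ∈ divide m H ↔ m • x ∈ H := by
  simp [AddSubgroup.mem_comap]

theorem divide_map_equiv (m : ℕ) (φ : G ≃+ G) (H : SubG G) :
    divide m (H.map φ.toAddMonoidHom) = (divide m H).map φ.toAddMonoidHom := by
  ext x
  simp only [mem_divide, AddSubgroup.mem_map_equiv, map_nsmul]

theorem map_divide {m : ℕ} {H : SubG G} (h : H ≤ multiples G m) :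
    (divide m H).map (zsmulAddGroupHom (m : ℤ) : G →+ G) = H := by
  refine le_antisymm (AddSubgroup.map_comap_le _ _) fun g hg => ?_
  obtain ⟨a, rfl⟩ := mem_multiples.1 (h hg)
  exact ⟨a, mem_divide.2 hg, by simp⟩

/-- `H` is a subgroup of `m G`, and `m G ⧸ H ≃ K`. -/
structure HasType (m : ℕ) (K : Type*) [AddCommGroup K] (H : SubG G) : Prop where
  le_multiples : H ≤ multiples G m
  isKernelOnto : IsKernelOnto K (divide m H)

theorem measurableSet_hasType [Countable G] [Finite K] (m : ℕ) :
    MeasurableSet {H : SubG G | HasType m K H} := by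
  have : {H : SubG G | HasType m K H} = (⋂ g : {g // g ∉ multiples G m}, {H : SubG G | g.1 ∉ H}) ∩
      divide m ⁻¹' {H : SubG G | IsKernelOnto K H} := by
    ext H
    simp only [Set.mem_ofPred_eq, Set.mem_inter_iff, Set.mem_iInter, Subtype.forall,
      Set.mem_preimage]
    exact ⟨fun h => ⟨fun g hg hgH => hg (h.1 hgH), h.2⟩,
      fun h => ⟨fun g hg => by_contra fun hgm => h.1 g hgm hg, h.2⟩⟩
  rw [this]
  exact (MeasurableSet.iInter fun g => measurableSet_setOf_notMem _).inter
    (measurable_comap _ measurableSet_isKernelOnto)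

theorem HasType.map_equiv {m : ℕ} {H : SubG G} (h : HasType m K H) (φ : G ≃+ G) :
    HasType m K (H.map φ.toAddMonoidHom) := by
  refine ⟨?_, ?_⟩
  · intro g hg
    obtain ⟨x, hx, rfl⟩ := hg
    obtain ⟨a, rfl⟩ := mem_multiples.1 (h.1 hx)
    exact ⟨φ a, by simp⟩
  · rw [divide_map_equiv]
    exact h.2.map_equiv φ

theorem hasType_map_equiv_iff {m : ℕ} {H : SubG G} (φ : G ≃+ G) :
    HasType m K (H.map φ.toAddMonoidHom) ↔ HasType m K H := by
  refine ⟨fun h => ?_, fun h => h.map_equiv φ⟩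
  have := h.map_equiv φ.symm
  convert this
  ext x
  simp only [AddSubgroup.mem_map_equiv, AddEquiv.symm_symm, AddEquiv.symm_apply_apply]

end Types

/-- There is at most one characteristic random subgroup of `𝒜 n` of a given type. -/
theorem CRS.eq_of_hasType {n m : ℕ} {K : Type*} [AddCommGroup K] [Finite K]
    {μ ν : Measure (SubG (𝒜 n))} (hμ : μ ∈ CRS (𝒜 n)) (hν : ν ∈ CRS (𝒜 n))
    (hμK : ∀ᵐ H ∂μ, HasType m K H) (hνK : ∀ᵐ H ∂ν, HasType m K H) : μ = ν := by
  have hd : Measurable (divide m : SubG (𝒜 n) → SubG (𝒜 n)) := measurable_comap _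
  -- On subgroups of `m 𝒜 n`, multiplication by `m` inverts `divide m`, so the law is recovered from
  -- that of `divide m H`, whose quotient is `K`.
  have hrec : ∀ ρ : Measure (SubG (𝒜 n)), (∀ᵐ H ∂ρ, HasType m K H) →
      (ρ.map (divide m)).map
        (fun H => (H.map (zsmulAddGroupHom (m : ℤ) : 𝒜 n →+ 𝒜 n) : SubG (𝒜 n))) = ρ := by
    intro ρ hρ
    rw [Measure.map_map (measurable_map _) hd]
    conv_rhs => rw [← Measure.map_id (μ := ρ)]
    refine Measure.map_congr ?_
    filter_upwards [hρ] with H hH using map_divide hH.1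
  have hker : ∀ ρ : Measure (SubG (𝒜 n)), (∀ᵐ H ∂ρ, HasType m K H) →
      ∀ᵐ H ∂(ρ.map (divide m)), IsKernelOnto K H := by
    intro ρ hρ
    refine (ae_map_iff hd.aemeasurable measurableSet_isKernelOnto).2 ?_
    filter_upwards [hρ] with H hH using hH.2
  rw [← hrec μ hμK, ← hrec ν hνK, CRS.eq_of_isKernelOnto (CRS.map_comap_zsmul hμ m)
    (CRS.map_comap_zsmul hν m) (hker μ hμK) (hker ν hνK)]

/-! ### Haar-random homomorphisms and their kernels -/

section Haar

variable {G F : Type*} [AddCommGroup G] [AddCommGroup F]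

theorem isClopen_setOf_apply_mem (g : G) (s : Set F) : IsClopen {h : HomGroup G F | h g ∈ s} := by
  let : TopologicalSpace F := ⊥
  have : DiscreteTopology F := ⟨rfl⟩
  have hc : Continuous fun h : HomGroup G F => h g :=
    (continuous_apply g).comp
      (continuous_induced_dom (f := (HomGroup.evalHom : HomGroup G F → G → F)))
  exact (isClopen_discrete s).preimage hc

theorem measurableSet_setOf_apply_mem (g : G) (s : Set F) :
    MeasurableSet {h : HomGroup G F | h g ∈ s} :=
  (isClopen_setOf_apply_mem g s).isOpen.measurableSet

theorem mem_ker {h : HomGroup G F} {g : G} : g ∈ h.ker ↔ h g = 0 := Iff.rfl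

instance [Finite F] : (homHaar G F).IsAddHaarMeasure :=
  inferInstanceAs (Measure.addHaarMeasure ⊤).IsAddHaarMeasure

instance [Finite F] : IsProbabilityMeasure (homHaar G F) :=
  ⟨Measure.addHaarMeasure_self (K₀ := (⊤ : TopologicalSpace.PositiveCompacts (HomGroup G F)))⟩

/-- An element of `HomGroup G F` as a homomorphism. -/
def HomGroup.toHom (h : HomGroup G F) : G →+ F := h

theorem HomGroup.toHom_apply (h : HomGroup G F) (g : G) : h.toHom g = h g := rfl

theorem measurable_multiples_inf_ker [Countable G] (m : ℕ) :
    Measurable fun h : HomGroup G F => (multiples G m ⊓ h.ker : SubG G) := by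
  refine measurable_iff_mem.2 fun g => ?_
  simp only [AddSubgroup.mem_inf, mem_ker]
  exact (MeasurableSet.const _).inter (measurableSet_setOf_apply_mem g {0})

/-- Precomposition with an automorphism of `G`, as an automorphism of `Hom(G, F)`. -/
def precomp (φ : G ≃+ G) : HomGroup G F ≃+ HomGroup G F where
  toFun h := AddMonoidHom.comp h φ.toAddMonoidHom
  invFun h := AddMonoidHom.comp h φ.symm.toAddMonoidHom
  left_inv h := by
    refine DFunLike.ext _ _ fun x => ?_
    exact congrArg h (φ.apply_symm_apply x)
  right_inv h := by
    refine DFunLike.ext _ _ fun x => ?_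
    exact congrArg h (φ.symm_apply_apply x)
  map_add' _ _ := rfl

theorem precomp_apply (φ : G ≃+ G) (h : HomGroup G F) (x : G) : precomp φ h x = h (φ x) := rfl

theorem continuous_precomp (φ : G ≃+ G) : Continuous (precomp φ : HomGroup G F → HomGroup G F) := by
  let : TopologicalSpace F := ⊥
  refine continuous_induced_rng.2 (continuous_pi fun g => ?_)
  exact (continuous_apply (φ g)).comp
    (continuous_induced_dom (f := (HomGroup.evalHom : HomGroup G F → G → F)))

theorem map_precomp_homHaar [Finite F] (φ : G ≃+ G) :
    (homHaar G F).map (precomp φ) = homHaar G F := by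
  have := AddEquiv.isAddHaarMeasure_map (homHaar G F) (precomp φ) (continuous_precomp φ)
    (continuous_precomp φ.symm)
  have : IsProbabilityMeasure ((homHaar G F).map (precomp φ)) :=
    Measure.isProbabilityMeasure_map (continuous_precomp φ).aemeasurable
  exact Measure.isAddHaarMeasure_eq_of_isProbabilityMeasure _ _

end Haar

variable {n : ℕ} {F : Type*} [AddCommGroup F]

/-- The homomorphism from `ℤ/nℤ` that sends `1` to `y`. -/
def zmodHom (y : F) (hy : n • y = 0) : ZMod n →+ F :=
  ZMod.lift n ⟨zmultiplesHom F y, by simpa using hy⟩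

theorem zmodHom_intCast (y : F) (hy : n • y = 0) (z : ℤ) : zmodHom y hy (z : ZMod n) = z • y := by
  rw [zmodHom, ZMod.lift_coe]
  rfl

/-- A homomorphism on `𝒜 n` with prescribed value on one basis vector, zero on the others. -/
noncomputable def singleHom (i : ℕ) (y : F) (hy : n • y = 0) : HomGroup (𝒜 n) F :=
  (zmodHom y hy).comp (Finsupp.applyAddHom i)

theorem singleHom_single_same (i : ℕ) (y : F) (hy : n • y = 0) :
    singleHom i y hy (Finsupp.single i 1) = y := by
  change zmodHom y hy ((Finsupp.single i 1 : 𝒜 n) i) = y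
  rw [Finsupp.single_eq_same, ← Int.cast_one, zmodHom_intCast, one_zsmul]

theorem singleHom_single_of_ne {i j : ℕ} (hij : i ≠ j) (y : F) (hy : n • y = 0) :
    singleHom j y hy (Finsupp.single i 1) = 0 := by
  change zmodHom y hy ((Finsupp.single i 1 : 𝒜 n) j) = 0
  rw [Finsupp.single_eq_of_ne hij.symm, map_zero]

/-- Multiplication by `m`, as a homomorphism onto `m F`. -/
def toMultiples (m : ℕ) : F →+ multiples F m :=
  (nsmulAddMonoidHom m : F →+ F).codRestrict (multiples F m) fun x => ⟨x, rfl⟩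

theorem toMultiples_surjective (m : ℕ) : Function.Surjective (toMultiples m : F → multiples F m) :=
  fun y => by
    obtain ⟨x, hx⟩ := mem_multiples.1 y.2
    exact ⟨x, Subtype.ext hx⟩

theorem coe_toMultiples (m : ℕ) (x : F) : (toMultiples m x : F) = m • x := rfl

variable [Finite F]

/-- Precomposition with an automorphism preserves Haar measure, and `m 𝒜 n` is a characteristic
subgroup. -/
theorem kerLaw_mem_CRS (m : ℕ) : kerLaw n m F ∈ CRS (𝒜 n) := by
  have hmeas := measurable_multiples_inf_ker (G := 𝒜 n) (F := F) m
  refine ⟨Measure.isProbabilityMeasure_map hmeas.aemeasurable, fun φ => ?_⟩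
  rw [kerLaw, Measure.map_map (measurable_map_equiv φ) hmeas]
  conv_rhs => rw [← map_precomp_homHaar φ.symm,
    Measure.map_map hmeas (continuous_precomp φ.symm).measurable]
  congr 1
  ext h x
  simp only [Function.comp_apply, AddSubgroup.mem_map_equiv, AddSubgroup.mem_inf, mem_ker,
    precomp_apply, mem_multiples]
  refine and_congr_left fun _ => ⟨?_, ?_⟩
  · rintro ⟨a, ha⟩
    exact ⟨φ a, by rw [← map_nsmul, ha, AddEquiv.apply_symm_apply]⟩
  · rintro ⟨a, rfl⟩
    exact ⟨φ.symm a, by rw [map_nsmul]⟩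

/-- A Haar-random homomorphism from `𝒜 n` to a finite group killed by `n` is almost surely
surjective. -/
theorem ae_surjective_homHaar (hF : ∀ x : F, n • x = 0) :
    ∀ᵐ h : HomGroup (𝒜 n) F ∂(homHaar (𝒜 n) F), Function.Surjective h.toHom := by
  have key : ∀ F' : AddSubgroup F, F' ≠ ⊤ → ∀ᵐ h ∂(homHaar (𝒜 n) F), ¬ ∀ a, h a ∈ F' := by
    intro F' hF'
    obtain ⟨y, hy⟩ : ∃ y, y ∉ F' := by
      by_contra! h
      exact hF' ((AddSubgroup.eq_top_iff' F').2 h)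
    set U : Set (HomGroup (𝒜 n) F) := {h | ∀ a, h a ∈ F'} with hU
    have hUm : MeasurableSet U := by
      rw [hU, Set.ofPred_forall]
      exact MeasurableSet.iInter fun a => measurableSet_setOf_apply_mem a (F' : Set F)
    change ∀ᵐ h ∂(homHaar (𝒜 n) F), h ∉ U
    rw [← measure_eq_zero_iff_ae_notMem]
    by_contra h0
    obtain ⟨r, hr⟩ := ENNReal.exists_nat_mul_gt h0 ENNReal.one_ne_top
    -- These translates of `U` have equal measure and are pairwise disjoint: on `V i` the value at
    -- the `i`-th basis vector lies in `-y + F'`, on every other `V j` in `F'`. Hence `U` is null.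
    let V : ℕ → Set (HomGroup (𝒜 n) F) := fun i => (fun h => singleHom i y (hF y) + h) ⁻¹' U
    have hVm : ∀ i, MeasurableSet (V i) := fun i => (measurable_const_add _) hUm
    have hV : ∀ i, homHaar (𝒜 n) F (V i) = homHaar (𝒜 n) F U := fun i =>
      measure_preimage_add _ _ _
    have hsum : homHaar (𝒜 n) F (⋃ i ∈ Finset.range r, V i) = r * homHaar (𝒜 n) F U := by
      rw [measure_biUnion_finset ?_ fun i _ => hVm i, Finset.sum_congr rfl fun i _ => hV i,
        Finset.sum_const, Finset.card_range, nsmul_eq_mul]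
      intro i _ j _ hij
      refine Set.disjoint_left.2 fun h h1 h2 => hy ?_
      have e1 : singleHom i y (hF y) (Finsupp.single i 1) + h (Finsupp.single i 1) ∈ F' :=
        h1 (Finsupp.single i 1)
      have e2 : singleHom j y (hF y) (Finsupp.single i 1) + h (Finsupp.single i 1) ∈ F' :=
        h2 (Finsupp.single i 1)
      rw [singleHom_single_same] at e1
      rw [singleHom_single_of_ne hij, zero_add] at e2
      exact (AddSubgroup.add_mem_cancel_right _ e2).1 e1
    rw [← hsum] at hr
    exact absurd hr (not_lt.2 prob_le_one)
  have : ∀ᵐ h ∂(homHaar (𝒜 n) F), ∀ F' : AddSubgroup F, F' ≠ ⊤ → ¬ ∀ a, h a ∈ F' :=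
    ae_all_iff.2 fun F' => by
      by_cases h : F' = ⊤
      · simp [h]
      · simpa [h] using key F' h
  filter_upwards [this] with h hh
  have : h.toHom.range = ⊤ := by
    by_contra hne
    exact hh _ hne fun a => ⟨a, rfl⟩
  exact AddMonoidHom.range_eq_top.1 this

/-- The random subgroup `m 𝒜 n ∩ ker h` almost surely has quotient `m F` in `m 𝒜 n`. -/
theorem ae_hasType_kerLaw (m : ℕ) (hF : ∀ x : F, n • x = 0) :
    ∀ᵐ H ∂(kerLaw n m F), HasType m (multiples F m) H := by
  refine (ae_map_iff (measurable_multiples_inf_ker m).aemeasurable (measurableSet_hasType m)).2 ?_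
  filter_upwards [ae_surjective_homHaar hF] with h hh
  -- `m x` lies in `m 𝒜 n ∩ ker h` exactly when `m h(x) = 0`, so dividing by `m` yields the kernel
  -- of `m h`.
  refine ⟨inf_le_left, (toMultiples m).comp h.toHom, (toMultiples_surjective m).comp hh, ?_⟩
  ext x
  rw [mem_divide, AddMonoidHom.mem_ker, AddSubgroup.mem_inf, mem_ker, map_nsmul,
    and_iff_right (mem_multiples.2 ⟨x, rfl⟩), Subtype.ext_iff, AddMonoidHom.comp_apply,
    coe_toMultiples, HomGroup.toHom_apply]
  rfl

/-! ### Finite abelian groups over `m` -/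

section FiniteGroups

/-- Every finite abelian group is a product of finitely many cyclic groups of prime power order. -/
theorem exists_equiv_pi_zmod (F : Type*) [AddCommGroup F] [Finite F] :
    ∃ (r : ℕ) (p e : Fin r → ℕ), (∀ i, (p i).Prime) ∧
      Nonempty (F ≃+ ∀ i, ZMod (p i ^ e i)) := by
  classical
  obtain ⟨ι, _, p, hp, e, ⟨E⟩⟩ := AddCommGroup.equiv_directSum_zmod_of_finite F
  let σ := Fintype.equivFin ι
  refine ⟨Fintype.card ι, p ∘ σ.symm, e ∘ σ.symm, fun i => hp _, ⟨(E.trans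
    (DirectSum.addEquivProd _)).trans ((LinearEquiv.piCongrLeft' ℤ _ σ).toAddEquiv)⟩⟩

theorem piSingle_eq_zsmul {ι : Type*} [DecidableEq ι] {N : ι → ℕ} (i : ι) (z : ℤ) :
    (Pi.single i (z : ZMod (N i)) : ∀ j, ZMod (N j)) = z • Pi.single i 1 := by
  rw [← Pi.single_smul, zsmul_one]

/-- Provides the image of a generator of a cyclic group of order `N` when a homomorphism is to be
divided by `m`. -/
theorem exists_nsmul_eq_of_nsmul_eq_zero {F' : Type*} [AddCommGroup F'] {m N : ℕ} (hN : 0 < N)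
    {y : F'} (hy : y ∈ multiples F' m) (h : (N / m.gcd N) • y = 0) :
    ∃ g : F', m • g = y ∧ N • g = 0 := by
  obtain ⟨g, rfl⟩ := mem_multiples.1 hy
  have hd : 0 < m.gcd N := Nat.gcd_pos_of_pos_right _ hN
  obtain ⟨u, hu⟩ := Nat.gcd_dvd_left m N
  obtain ⟨N', hN'⟩ := Nat.gcd_dvd_right m N
  have hdiv : N / m.gcd N = N' := Nat.div_eq_of_eq_mul_right hd hN'
  rw [hdiv] at h
  have hco : IsCoprime (u : ℤ) (N' : ℤ) := by
    rw [Nat.isCoprime_iff_coprime]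
    have hg : m.gcd N * u.gcd N' = m.gcd N * 1 := by
      rw [← Nat.gcd_mul_left, ← hu, ← hN', mul_one]
    exact Nat.eq_of_mul_eq_mul_left hd hg
  obtain ⟨a, b, hab⟩ := hco
  -- The factor `a * u` is `1` modulo `N'`, which kills `m • g`, so the product with `m` is
  -- unchanged; and `u * N = N' * m` makes `N` annihilate the new element.
  refine ⟨(a * u) • g, ?_, ?_⟩
  · have h' : (N' : ℤ) • m • g = 0 := by rw [natCast_zsmul, h]
    rw [smul_comm, show a * (u : ℤ) = 1 - b * N' by linarith, sub_zsmul, one_zsmul, mul_zsmul, h',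
      zsmul_zero, neg_zero, add_zero]
  · have h' : (u : ℤ) • N • g = 0 := by
      have hmul : u * N = N' * m := by
        conv_lhs => rw [hN']
        conv_rhs => rw [hu]
        ring
      rw [natCast_zsmul, smul_smul, hmul, mul_smul, h]
    rw [smul_comm, mul_zsmul, h', zsmul_zero]

theorem exists_lift_pi {ι : Type*} [Fintype ι] {N : ι → ℕ} (hN : ∀ i, 0 < N i) {F' : Type*}
    [AddCommGroup F'] {m : ℕ} (θ : (∀ i, ZMod (N i)) →+ F') (h1 : ∀ x, θ x ∈ multiples F' m)
    (h2 : ∀ x, m • x = 0 → θ x = 0) :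
    ∃ Θ : (∀ i, ZMod (N i)) →+ F', ∀ x, m • Θ x = θ x := by
  classical
  have hex : ∀ i, ∃ g : F', m • g = θ (Pi.single i 1) ∧ N i • g = 0 := by
    intro i
    refine exists_nsmul_eq_of_nsmul_eq_zero (hN i) (h1 _) ?_
    rw [← map_nsmul]
    refine h2 _ ?_
    obtain ⟨u, hu⟩ := Nat.gcd_dvd_left m (N i)
    have : m * (N i / m.gcd (N i)) = u * N i := by
      obtain ⟨N', hN'⟩ := Nat.gcd_dvd_right m (N i)
      rw [Nat.div_eq_of_eq_mul_right (Nat.gcd_pos_of_pos_right _ (hN i)) hN']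
      conv_lhs => rw [hu]
      conv_rhs => rw [hN']
      ring
    rw [smul_smul, this, mul_smul, ← Pi.single_smul, nsmul_one, ZMod.natCast_self, Pi.single_zero,
      smul_zero]
  choose g hg hNg using hex
  let Θ : (∀ i, ZMod (N i)) →+ F' :=
    ∑ i, (zmodHom (g i) (hNg i)).comp (Pi.evalAddMonoidHom (fun i => ZMod (N i)) i)
  have hΘ : ∀ i, Θ (Pi.single i 1) = g i := by
    intro i
    simp only [Θ, AddMonoidHom.finsetSum_apply, AddMonoidHom.comp_apply, Pi.evalAddMonoidHom_apply]
    rw [Finset.sum_eq_single i]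
    · rw [Pi.single_eq_same, ← Int.cast_one, zmodHom_intCast, one_zsmul]
    · intro j _ hj
      rw [Pi.single_eq_of_ne hj, map_zero]
    · simp
  refine ⟨Θ, fun x => ?_⟩
  refine DFunLike.congr_fun (f := m • Θ) (AddMonoidHom.functions_ext _ _ _ fun i x => ?_) x
  obtain ⟨z, rfl⟩ := ZMod.intCast_surjective x
  rw [piSingle_eq_zsmul, map_zsmul, map_zsmul, AddMonoidHom.smul_apply, hΘ, hg]

/-- A homomorphism from a finite group `F` into `m F'` that factors through multiplication by `m`
is divisible by `m`. -/
theorem exists_lift {F F' : Type*} [AddCommGroup F] [Finite F] [AddCommGroup F'] {m : ℕ}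
    (θ : F →+ F') (h1 : ∀ x, θ x ∈ multiples F' m) (h2 : ∀ x, m • x = 0 → θ x = 0) :
    ∃ Θ : F →+ F', ∀ x, m • Θ x = θ x := by
  obtain ⟨r, p, e, hp, ⟨E⟩⟩ := exists_equiv_pi_zmod F
  obtain ⟨Θ, hΘ⟩ := exists_lift_pi (fun i => pow_pos (hp i).pos (e i))
    (θ.comp E.symm.toAddMonoidHom) (fun x => h1 _)
    (fun x hx => h2 _ (by
      change m • E.symm x = 0
      rw [← map_nsmul, hx, map_zero]))
  refine ⟨Θ.comp E.toAddMonoidHom, fun x => ?_⟩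
  have := hΘ (E x)
  simpa using this

/-- All elements of prime order of `F` are multiples of `m`. -/
def PrimeOrderMultiple (m : ℕ) (F : Type*) [AddCommGroup F] : Prop :=
  ∀ (q : ℕ) (x : F), q.Prime → q • x = 0 → x ∈ multiples F m

theorem PrimeOrderMultiple.congr {m : ℕ} {F F' : Type*} [AddCommGroup F] [AddCommGroup F']
    (h : PrimeOrderMultiple m F) (E : F ≃+ F') : PrimeOrderMultiple m F' := by
  intro q x hq hx
  obtain ⟨a, ha⟩ := mem_multiples.1 (h q (E.symm x) hq (by rw [← map_nsmul, hx, map_zero]))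
  exact ⟨E a, by simp [← map_nsmul, ha]⟩

theorem exists_prime_nsmul_eq_zero {F : Type*} [AddCommGroup F] [Finite F] {H : AddSubgroup F}
    (hH : H ≠ ⊥) : ∃ q : ℕ, q.Prime ∧ ∃ x ∈ H, x ≠ 0 ∧ q • x = 0 := by
  have hne : Nat.card H ≠ 1 := fun h => hH (AddSubgroup.eq_bot_of_card_eq H h)
  have hq := Nat.minFac_prime hne
  have : Fact (Nat.card H).minFac.Prime := ⟨hq⟩
  obtain ⟨x, hx⟩ := exists_prime_addOrderOf_dvd_card' (G := H) (Nat.card H).minFac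
    (Nat.minFac_dvd _)
  refine ⟨_, hq, x, x.2, fun h0 => ?_, ?_⟩
  · have : x = 0 := Subtype.ext h0
    rw [this, addOrderOf_zero] at hx
    exact hq.one_lt.ne hx
  · rw [← hx, ← AddSubgroup.coe_nsmul, addOrderOf_nsmul_eq_zero, AddSubgroup.coe_zero]

/-- If `m F₁ = 0`, an element of prime order in `F₁` is `m (a + b) = m b` with `b ∈ F₂`, hence lies
in `F₁ ∩ F₂ = 0`. -/
theorem PrimeOrderMultiple.isOver {m : ℕ} {F : Type*} [AddCommGroup F] [Finite F]
    (h : PrimeOrderMultiple m F) : IsOver m F := by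
  intro F₁ F₂ hc hne
  obtain ⟨q, hq, x, hx, hx0, hqx⟩ := exists_prime_nsmul_eq_zero hne
  by_contra! hall
  obtain ⟨z, rfl⟩ := mem_multiples.1 (h q x hq hqx)
  have hz : z ∈ F₁ ⊔ F₂ := hc.sup_eq_top ▸ AddSubgroup.mem_top z
  obtain ⟨a, ha, b, hb, rfl⟩ := AddSubgroup.mem_sup.1 hz
  rw [nsmul_add, hall a ha, zero_add] at hx hx0
  exact hx0 (AddSubgroup.disjoint_def.1 hc.disjoint hx (F₂.nsmul_mem hb m))

/-- In a nontrivial factor `gcd(m, p ^ e) = p ^ j` with `j < e`. An element killed by a prime `q` is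
divisible by `p ^ (e - 1)` if `q = p` and is zero otherwise; so `p ^ j` divides it, and by Bézout so
does `m`. -/
theorem primeOrderMultiple_pi {ι : Type*} {p e : ι → ℕ} (hp : ∀ i, (p i).Prime) {m : ℕ}
    (h : ∀ i, e i = 0 ∨ ¬ p i ^ e i ∣ m) : PrimeOrderMultiple m (∀ i, ZMod (p i ^ e i)) := by
  intro q x hq hx
  suffices ∀ i, ∃ z : ZMod (p i ^ e i), m • z = x i by
    choose z hz using this
    exact ⟨z, funext hz⟩
  intro i
  rcases h i with h0 | hnd
  · have : Subsingleton (ZMod (p i ^ e i)) := by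
      rw [h0, pow_zero]
      infer_instance
    exact ⟨0, Subsingleton.elim _ _⟩
  obtain ⟨a, ha⟩ := ZMod.intCast_surjective (x i)
  obtain ⟨j, hj, hgcd⟩ := (Nat.dvd_prime_pow (hp i)).1 (Nat.gcd_dvd_right m (p i ^ e i))
  have hje : j < e i := by
    refine lt_of_le_of_ne hj fun hje => hnd ?_
    rw [← hje, ← hgcd]
    exact Nat.gcd_dvd_left _ _
  have hqa : ((p i ^ e i : ℕ) : ℤ) ∣ q * a := by
    rw [← ZMod.intCast_zmod_eq_zero_iff_dvd]
    have := congrFun hx i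
    rw [Pi.smul_apply, ← ha, nsmul_eq_mul] at this
    push_cast
    exact this
  have hdvd : ((m.gcd (p i ^ e i) : ℕ) : ℤ) ∣ a := by
    rw [hgcd]
    by_cases hqp : q = p i
    · rw [← Nat.sub_add_cancel (Nat.one_le_of_lt hje), pow_succ', hqp, Nat.cast_mul] at hqa
      have := Int.dvd_of_mul_dvd_mul_left (Nat.cast_ne_zero.2 (hp i).ne_zero) hqa
      refine dvd_trans ?_ this
      exact Int.natCast_dvd_natCast.2 (pow_dvd_pow _ (by omega))
    · have hco : IsCoprime ((p i ^ e i : ℕ) : ℤ) (q : ℤ) := by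
        rw [Nat.isCoprime_iff_coprime]
        exact Nat.Coprime.pow_left _ ((Nat.coprime_primes (hp i) hq).2 (Ne.symm hqp))
      exact dvd_trans (Int.natCast_dvd_natCast.2 (pow_dvd_pow _ hj)) (hco.dvd_of_dvd_mul_left hqa)
  obtain ⟨s, t, hst⟩ : ∃ s t : ℤ, a = m * s + (p i ^ e i : ℕ) * t := by
    obtain ⟨b, rfl⟩ := hdvd
    refine ⟨m.gcdA (p i ^ e i) * b, m.gcdB (p i ^ e i) * b, ?_⟩
    rw [Nat.gcd_eq_gcd_ab]
    ring
  refine ⟨(s : ZMod (p i ^ e i)), ?_⟩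
  rw [← ha, hst, nsmul_eq_mul]
  push_cast
  have : ((p i : ZMod (p i ^ e i)) ^ e i) = 0 := by
    rw [← Nat.cast_pow, ZMod.natCast_self]
  rw [this, zero_mul, add_zero]

/-- Each cyclic factor is a direct summand, killed by `m` as soon as its order divides `m`. -/
theorem IsOver.not_dvd_pi {ι : Type*} {N : ι → ℕ} {m : ℕ}
    (h : IsOver m (∀ i, ZMod (N i))) (i : ι) : N i = 1 ∨ ¬ N i ∣ m := by
  classical
  by_contra! hcon
  let F₁ : AddSubgroup (∀ i, ZMod (N i)) := (AddMonoidHom.single (fun i => ZMod (N i)) i).range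
  let F₂ : AddSubgroup (∀ i, ZMod (N i)) := (Pi.evalAddMonoidHom (fun i => ZMod (N i)) i).ker
  have hc : IsCompl F₁ F₂ := by
    constructor
    · rw [AddSubgroup.disjoint_def]
      rintro _ ⟨a, rfl⟩ h2
      have : a = 0 := by simpa [F₂, AddMonoidHom.mem_ker] using h2
      rw [this, map_zero]
    · rw [codisjoint_iff, AddSubgroup.eq_top_iff']
      intro x
      refine AddSubgroup.mem_sup.2 ⟨Pi.single i (x i), ⟨x i, rfl⟩, x - Pi.single i (x i), ?_, ?_⟩
      · simp [F₂, AddMonoidHom.mem_ker]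
      · abel
  have hne : F₁ ≠ ⊥ := by
    intro hbot
    have h1 : (Pi.single i 1 : ∀ i, ZMod (N i)) ∈ F₁ := ⟨1, rfl⟩
    rw [hbot, AddSubgroup.mem_bot, Pi.single_eq_zero_iff] at h1
    apply hcon.1
    have := ZMod.natCast_eq_zero_iff 1 (N i)
    rw [Nat.cast_one] at this
    exact Nat.dvd_one.1 (this.1 h1)
  obtain ⟨x, ⟨a, rfl⟩, hx⟩ := h F₁ F₂ hc hne
  apply hx
  rw [← map_nsmul, nsmul_eq_mul, (ZMod.natCast_eq_zero_iff m (N i)).2 hcon.2, zero_mul, map_zero]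

theorem IsOver.congr {m : ℕ} {F F' : Type*} [AddCommGroup F] [AddCommGroup F'] (h : IsOver m F)
    (E : F ≃+ F') : IsOver m F' := by
  intro F₁ F₂ hc hne
  have hc' : IsCompl (F₁.comap E.toAddMonoidHom) (F₂.comap E.toAddMonoidHom) :=
    hc.map (E.comapAddSubgroup)
  have hne' : F₁.comap E.toAddMonoidHom ≠ ⊥ := by
    intro hb
    refine hne ((AddSubgroup.eq_bot_iff_forall _).2 fun x hx => ?_)
    have : E.symm x ∈ F₁.comap E.toAddMonoidHom := by simpa using hx
    rw [hb, AddSubgroup.mem_bot] at this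
    simpa using this
  obtain ⟨x, hx, hmx⟩ := h _ _ hc' hne'
  refine ⟨E x, hx, fun h0 => hmx ?_⟩
  rwa [← map_nsmul, EmbeddingLike.map_eq_zero_iff] at h0

theorem IsOver.primeOrderMultiple {m : ℕ} {F : Type*} [AddCommGroup F] [Finite F]
    (h : IsOver m F) : PrimeOrderMultiple m F := by
  obtain ⟨r, p, e, hp, ⟨E⟩⟩ := exists_equiv_pi_zmod F
  refine (primeOrderMultiple_pi hp fun i => ?_).congr E.symm
  refine ((h.congr E).not_dvd_pi i).imp_left fun h1 => ?_
  exact (Nat.pow_eq_one.1 h1).resolve_left (hp i).ne_one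

/-- Lift `E` to `Θ` with `m Θ(x) = E(m x)`. An element of prime order in the kernel would be some `m
z`, and `Θ(m z) = E(m z)` vanishes only if `m z = 0`. -/
theorem IsOver.exists_injective {m : ℕ} {F F' : Type*} [AddCommGroup F] [Finite F]
    [AddCommGroup F'] (h : IsOver m F) (E : multiples F m ≃+ multiples F' m) :
    ∃ Θ : F →+ F', Function.Injective Θ := by
  obtain ⟨Θ, hΘ⟩ := exists_lift (m := m)
    ((multiples F' m).subtype.comp (E.toAddMonoidHom.comp (toMultiples m)))
    (fun x => (E (toMultiples m x)).2) (fun x hx => by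
      have : toMultiples m x = 0 := Subtype.ext hx
      simp [this])
  refine ⟨Θ, (AddMonoidHom.ker_eq_bot_iff Θ).1 ?_⟩
  by_contra hne
  obtain ⟨q, hq, x, hx, hx0, hqx⟩ := exists_prime_nsmul_eq_zero hne
  obtain ⟨z, rfl⟩ := mem_multiples.1 (h.primeOrderMultiple q x hq hqx)
  rw [AddMonoidHom.mem_ker, map_nsmul, hΘ] at hx
  have h1 : E (toMultiples m z) = 0 := Subtype.ext hx
  rw [EmbeddingLike.map_eq_zero_iff] at h1
  exact hx0 (congrArg Subtype.val h1)

/-- A finite abelian group `F` over `m` is determined by `m F`. -/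
theorem IsOver.nonempty_equiv {m : ℕ} {F F' : Type*} [AddCommGroup F] [Finite F]
    [AddCommGroup F'] [Finite F'] (h : IsOver m F) (h' : IsOver m F')
    (E : multiples F m ≃+ multiples F' m) : Nonempty (F ≃+ F') := by
  obtain ⟨Θ, hΘ⟩ := h.exists_injective E
  obtain ⟨Θ', hΘ'⟩ := h'.exists_injective E.symm
  have hcard : Nat.card F = Nat.card F' :=
    le_antisymm (Nat.card_le_card_of_injective Θ hΘ) (Nat.card_le_card_of_injective Θ' hΘ')
  exact ⟨AddEquiv.ofBijective Θ ((Nat.bijective_iff_injective_and_card Θ).2 ⟨hΘ, hcard⟩)⟩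

theorem dvd_mul_iff_of_eq_add_factorization {p e m : ℕ} (hp : p.Prime) (hm : m ≠ 0) (a : ℤ) :
    ((p ^ (e + m.factorization p) : ℕ) : ℤ) ∣ m * a ↔ ((p ^ e : ℕ) : ℤ) ∣ a := by
  have hm' : (m : ℤ) = (p ^ m.factorization p : ℕ) * (m / p ^ m.factorization p : ℕ) := by
    rw [← Nat.cast_mul, Nat.ordProj_mul_ordCompl_eq_self]
  have hpos : ((p ^ m.factorization p : ℕ) : ℤ) ≠ 0 :=
    Nat.cast_ne_zero.2 (pow_ne_zero _ hp.ne_zero)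
  have hco : IsCoprime ((p ^ e : ℕ) : ℤ) ((m / p ^ m.factorization p : ℕ) : ℤ) := by
    rw [Nat.isCoprime_iff_coprime]
    exact Nat.Coprime.pow_left _ (Nat.coprime_ordCompl hp hm)
  rw [pow_add, mul_comm (p ^ e), Nat.cast_mul, hm', mul_assoc, mul_dvd_mul_iff_left hpos]
  exact ⟨hco.dvd_of_dvd_mul_left, fun h => h.mul_left _⟩

/-- Every finite abelian group killed by `k`, and trivial if `m = 0`, is of the form `m F` for a
finite abelian group `F` over `m` that is killed by `m k`. -/
theorem exists_isOver (m : ℕ) {r : ℕ} {p e : Fin r → ℕ} (hp : ∀ i, (p i).Prime)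
    (hm : m = 0 → Subsingleton (∀ i, ZMod (p i ^ e i))) {k : ℕ}
    (hk : ∀ x : ∀ i, ZMod (p i ^ e i), k • x = 0) :
    ∃ (F : Type) (_ : AddCommGroup F) (_ : Finite F), IsOver m F ∧ (∀ x : F, (m * k) • x = 0) ∧
      Nonempty (multiples F m ≃+ ∀ i, ZMod (p i ^ e i)) := by
  have hm0 : ∀ i, m = 0 → e i = 0 := by
    intro i h
    have := hm h
    have h1 := congrFun (Subsingleton.elim (1 : ∀ i, ZMod (p i ^ e i)) 0) i
    rw [Pi.one_apply, Pi.zero_apply, ← Nat.cast_one, ZMod.natCast_eq_zero_iff, Nat.dvd_one] at h1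
    exact (Nat.pow_eq_one.1 h1).resolve_left (hp i).ne_one
  -- Multiplication by `m` removes exactly the added exponent. Trivial factors stay trivial: raising
  -- them would create factors killed by `m`.
  let f : Fin r → ℕ := fun i => if e i = 0 then 0 else e i + m.factorization (p i)
  have hef : ∀ i, e i ≤ f i := by
    intro i
    simp only [f]
    split_ifs <;> omega
  have hker : ∀ i (a : ℤ), ((p i ^ f i : ℕ) : ℤ) ∣ m * a ↔ ((p i ^ e i : ℕ) : ℤ) ∣ a := by
    intro i a
    by_cases h0 : e i = 0
    · simp [f, h0]
    · simp only [f, if_neg h0]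
      exact dvd_mul_iff_of_eq_add_factorization (hp i) (fun h => h0 (hm0 i h)) a
  have hne : ∀ i, NeZero (p i ^ f i) := fun i => ⟨pow_ne_zero _ (hp i).ne_zero⟩
  refine ⟨∀ i, ZMod (p i ^ f i), inferInstance, inferInstance, ?_, ?_, ?_⟩
  · refine (primeOrderMultiple_pi hp fun i => ?_).isOver
    by_cases h0 : e i = 0
    · left
      simp [f, h0]
    · right
      have hm' : m ≠ 0 := fun h => h0 (hm0 i h)
      rw [(hp i).pow_dvd_iff_le_factorization hm']
      simp only [f, if_neg h0]
      omega
  · intro x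
    funext i
    obtain ⟨a, ha⟩ := ZMod.intCast_surjective (x i)
    have h1 : ((p i ^ e i : ℕ) : ℤ) ∣ k := by
      have := congrFun (hk 1) i
      rw [Pi.smul_apply, Pi.one_apply, Pi.zero_apply, nsmul_one, ZMod.natCast_eq_zero_iff] at this
      exact Int.natCast_dvd_natCast.2 this
    have h2 : ((p i ^ f i : ℕ) : ℤ) ∣ ((m * k : ℕ) : ℤ) * a := by
      rw [Nat.cast_mul, mul_assoc]
      exact (hker i _).2 (h1.mul_right a)
    rw [Pi.smul_apply, Pi.zero_apply, ← ha, nsmul_eq_mul]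
    rw [← ZMod.intCast_zmod_eq_zero_iff_dvd] at h2
    push_cast at h2 ⊢
    exact h2
  · let c : (∀ i, ZMod (p i ^ f i)) →+ ∀ i, ZMod (p i ^ e i) := AddMonoidHom.mk'
      (fun x i => ZMod.castHom (pow_dvd_pow (p i) (hef i)) (ZMod (p i ^ e i)) (x i))
      (fun x y => funext fun i => map_add _ _ _)
    have hc : Function.Surjective c := by
      intro y
      have hs : ∀ i, ∃ x, ZMod.castHom (pow_dvd_pow (p i) (hef i)) (ZMod (p i ^ e i)) x = y i :=
        fun i => ZMod.castHom_surjective _ (y i)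
      choose x hx using hs
      exact ⟨x, funext hx⟩
    have h1 : IsKernelOnto (∀ i, ZMod (p i ^ e i)) c.ker := ⟨c, hc, rfl⟩
    -- By `hker`, multiplication by `m` and the coordinatewise reduction `c` have the same kernel,
    -- hence isomorphic images.
    refine IsKernelOnto.equiv ⟨toMultiples m, toMultiples_surjective m, ?_⟩ h1
    ext x
    rw [AddMonoidHom.mem_ker, AddMonoidHom.mem_ker, Subtype.ext_iff, coe_toMultiples,
      AddSubgroup.coe_zero, funext_iff, funext_iff]
    refine forall_congr' fun i => ?_
    change m • x i = 0 ↔ ZMod.castHom (pow_dvd_pow (p i) (hef i)) (ZMod (p i ^ e i)) (x i) = 0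
    obtain ⟨a, ha⟩ := ZMod.intCast_surjective (x i)
    rw [← ha, map_intCast, ZMod.intCast_zmod_eq_zero_iff_dvd, ← hker,
      ← ZMod.intCast_zmod_eq_zero_iff_dvd, nsmul_eq_mul]
    push_cast
    rfl

end FiniteGroups

/-! ### Existence and uniqueness of the description -/

section Types

variable {n : ℕ}

theorem nsmul_eq_zero_self (a : 𝒜 n) : n • a = 0 := by
  ext i
  simp

theorem HasType.nsmul_eq_zero {m k : ℕ} {K : Type*} [AddCommGroup K] {H : SubG (𝒜 n)}
    (h : HasType m K H) (hk : n = m * k) (x : K) : k • x = 0 := by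
  obtain ⟨f, hf, hker⟩ := h.isKernelOnto
  obtain ⟨a, rfl⟩ := hf x
  rw [← map_nsmul, ← AddMonoidHom.mem_ker, hker, mem_divide, smul_smul, ← hk, nsmul_eq_zero_self]
  exact H.zero_mem

theorem HasType.subsingleton {K : Type*} [AddCommGroup K] {H : SubG (𝒜 n)}
    (h : HasType 0 K H) : Subsingleton K := by
  obtain ⟨f, hf, hker⟩ := h.isKernelOnto
  refine subsingleton_of_forall_eq 0 fun x => ?_
  obtain ⟨a, rfl⟩ := hf x
  rw [← AddMonoidHom.mem_ker, hker, mem_divide, zero_nsmul]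
  exact H.zero_mem

/-- As `K` is finite, two basis vectors agree modulo `divide m H`. Then `m (e_i - e_j) ∈ H ≤ m' 𝒜
n`, and reading off the `i`-th coordinate gives `m' ∣ m` modulo `n`, which `m'` divides. -/
theorem HasType.dvd {m m' : ℕ} {K K' : Type*} [AddCommGroup K] [Finite K] [AddCommGroup K']
    {H : SubG (𝒜 n)} (h : HasType m K H) (h' : HasType m' K' H) (hm' : m' ∣ n) : m' ∣ m := by
  obtain ⟨f, -, hker⟩ := h.isKernelOnto
  obtain ⟨i, j, hij, hf⟩ :=
    Finite.exists_ne_map_eq_of_infinite fun i : ℕ => f (Finsupp.single i 1)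
  have hmem : (Finsupp.single i 1 - Finsupp.single j 1 : 𝒜 n) ∈ divide m H := by
    rw [← hker, AddMonoidHom.mem_ker, map_sub, sub_eq_zero]
    exact hf
  obtain ⟨a, ha⟩ := mem_multiples.1 (h'.le_multiples (mem_divide.1 hmem))
  have hi := DFunLike.congr_fun ha i
  rw [Finsupp.smul_apply, Finsupp.smul_apply, Finsupp.sub_apply, Finsupp.single_eq_same,
    Finsupp.single_eq_of_ne hij, sub_zero, nsmul_one, nsmul_eq_mul] at hi
  obtain ⟨z, hz⟩ := ZMod.intCast_surjective (a i)
  have hdvd : (n : ℤ) ∣ m' * z - m := by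
    rw [← ZMod.intCast_zmod_eq_zero_iff_dvd]
    push_cast
    rw [hz, hi, sub_self]
  have h1 := (Int.natCast_dvd_natCast.2 hm').trans hdvd
  exact Int.natCast_dvd_natCast.1 ((dvd_sub_right (dvd_mul_right _ _)).1 h1)

end Types

variable {n : ℕ} {μ : Measure (SubG (𝒜 n))}

/-- An indecomposable characteristic random subgroup of `𝒜 n` almost surely has a fixed type. -/
theorem CRSe.exists_ae_hasType (hμ : μ ∈ CRSe (𝒜 n)) :
    ∃ (m r : ℕ) (p e : Fin r → ℕ), m ∣ n ∧ (∀ i, (p i).Prime) ∧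
      ∀ᵐ H ∂μ, HasType m (∀ i, ZMod (p i ^ e i)) H := by
  have := hμ.1.1
  by_contra hcon
  -- The tuples `(m, r, p, e)` are countable in number and each type is an invariant event, of
  -- probability `0` or `1`. If none has probability `1`, almost surely no type occurs.
  have hnot : ∀ᵐ H ∂μ, ∀ (m r : ℕ) (p e : Fin r → ℕ), m ∣ n → (∀ i, (p i).Prime) →
      ¬ HasType m (∀ i, ZMod (p i ^ e i)) H := by
    simp only [ae_all_iff]
    intro m r p e hm hp
    have hne : ∀ i, NeZero (p i ^ e i) := fun i => ⟨pow_ne_zero _ (hp i).ne_zero⟩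
    have hmeas := measurableSet_hasType (G := 𝒜 n) (K := ∀ i, ZMod (p i ^ e i)) m
    by_contra h0
    refine hcon ⟨m, r, p, e, hm, hp, (mem_ae_iff_prob_eq_one hmeas).2 ?_⟩
    refine CRSe.measure_eq_one hμ hmeas (fun φ H => hasType_map_equiv_iff φ) fun hz => h0 ?_
    exact measure_eq_zero_iff_ae_notMem.1 hz
  obtain ⟨H, h1, m, hm, hle, hfin⟩ := (hnot.and (CRS.ae_exists_finiteIndex hμ.1)).exists
  have : Finite (𝒜 n ⧸ divide m H) := AddSubgroup.finite_quotient_of_finiteIndex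
  obtain ⟨r, p, e, hp, ⟨E⟩⟩ := exists_equiv_pi_zmod (𝒜 n ⧸ divide m H)
  have hker : IsKernelOnto (𝒜 n ⧸ divide m H) (divide m H) :=
    ⟨QuotientAddGroup.mk' _, QuotientAddGroup.mk'_surjective _, QuotientAddGroup.ker_mk' _⟩
  exact h1 m r p e hm hp ⟨hle, hker.congr E⟩

theorem CRSe.exists_isDescribedBy (hμ : μ ∈ CRSe (𝒜 n)) :
    ∃ (m : ℕ) (F : Type) (_ : AddCommGroup F) (_ : Finite F), IsDescribedBy n μ m F := by
  have := hμ.1.1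
  obtain ⟨m, r, p, e, ⟨k, hk⟩, hp, hae⟩ := CRSe.exists_ae_hasType hμ
  obtain ⟨H, hH⟩ := hae.exists
  obtain ⟨F, _, _, hover, hkill, ⟨E⟩⟩ := exists_isOver m hp
    (fun h0 => by subst h0; exact hH.subsingleton) fun x => hH.nsmul_eq_zero hk x
  rw [← hk] at hkill
  have hne : ∀ i, NeZero (p i ^ e i) := fun i => ⟨pow_ne_zero _ (hp i).ne_zero⟩
  refine ⟨m, F, inferInstance, inferInstance, hover, ⟨k, hk⟩, hkill,
    CRS.eq_of_hasType (K := ∀ i, ZMod (p i ^ e i)) (m := m) (kerLaw_mem_CRS m) hμ.1 ?_ hae⟩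
  filter_upwards [ae_hasType_kerLaw (n := n) m hkill] with H hH
  exact ⟨hH.1, hH.2.congr E⟩

/-- Some `H` has both types. Mutual divisibility gives `m' = m`, the quotient gives `m F' ≃ m F`,
and being over `m` gives `F' ≃ F`. -/
theorem IsDescribedBy.unique [IsProbabilityMeasure μ] {m m' : ℕ} {F F' : Type*} [AddCommGroup F]
    [Finite F] [AddCommGroup F'] [Finite F'] (h : IsDescribedBy n μ m F)
    (h' : IsDescribedBy n μ m' F') : m' = m ∧ Nonempty (F' ≃+ F) := by
  have h1 := ae_hasType_kerLaw (n := n) m h.nsmul_eq_zero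
  have h2 := ae_hasType_kerLaw (n := n) m' h'.nsmul_eq_zero
  rw [h.law] at h1
  rw [h'.law] at h2
  obtain ⟨H, hH, hH'⟩ := (h1.and h2).exists
  obtain rfl : m' = m := Nat.dvd_antisymm (hH.dvd hH' h'.dvd) (hH'.dvd hH h.dvd)
  obtain ⟨E⟩ := hH'.isKernelOnto.equiv hH.isKernelOnto
  exact ⟨rfl, h'.isOver.nonempty_equiv h.isOver E⟩

end CharRandomSubgroup

theorem theorem4 (n : ℕ)
    (μ : MeasureTheory.Measure (CharRandomSubgroup.SubG (CharRandomSubgroup.𝒜 n)))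
    (hμ : μ ∈ CharRandomSubgroup.CRSe (CharRandomSubgroup.𝒜 n)) :
    ∃ (m : ℕ) (F : Type) (_ : AddCommGroup F) (_ : Finite F),
      CharRandomSubgroup.IsDescribedBy n μ m F ∧
      ∀ (m' : ℕ) (F' : Type*) [AddCommGroup F'] [Finite F'],
        CharRandomSubgroup.IsDescribedBy n μ m' F' → m' = m ∧ Nonempty (F' ≃+ F) := by
  have := hμ.1.1
  obtain ⟨m, F, _, _, h⟩ := CharRandomSubgroup.CRSe.exists_isDescribedBy hμ
  exact ⟨m, F, inferInstance, inferInstance, h, fun m' F' _ _ h' => h.unique h'⟩
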